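/- Let $S>0$, let $M=(m_{ij})$ be a real $2\times 2$ matrix with $\det M>0$, let $\alpha\in[0,\pi)$, and let $\beta,\beta'\in(0,\pi]$ with $\beta\neq\beta'$. For real-valued $q\in L^2[-S,S]$ and $\gamma\in(0,\pi]$ let $\sigma_\gamma(q)\subset\mathbb C$ be the set of eigenvalues $\lambda$ of the problem $$-y''+q\,y=\lambda y\quad\text{on }[-S,0)\cup(0,S],\qquad \begin{pmatrix}y(0^+)\\ y'(0^+)\end{pmatrix}=M\begin{pmatrix}y(0^-)\\ y'(0^-)\end{pmatrix},$$ $$y(-S)\cos\alpha-y'(-S)\sin\alpha=0,\qquad y(S)\cos\gamma-y'(S)\sin\gamma=0,$$ that is, of all $\lambda$ for which there is a solution $y\not\equiv0$ such that $y,y'$ are absolutely continuous on each of $[-S,0)$ and $(0,S]$ up to the one-sided limits at $0$ and the differential equation holds almost everywhere. Then, for given $M,\alpha,\beta,\beta'$, the two spectra $\sigma_\beta(q)$ and $\sigma_{\beta'}(q)$ determine $q$ uniquely: if $q,r\in L^2[-S,S]$ are real-valued with $\sigma_\beta(q)=\sigma_\beta(r)$ and $\sigma_{\beta'}(q)=\sigma_{\beta'}(r)$,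 then $q=r$ almost everywhere on $[-S,S]$. -/

import Mathlib

open Set MeasureTheory

/-- `y` is a (Carathéodory) solution of `-y'' + q y = lam y` on `[a, b]` with derivative `dy`:
`y` is differentiable on `[a, b]` (one-sidedly at the end points) with derivative `dy`, `dy` is
absolutely continuous on `[a, b]`, and `y'' = (q - lam) y` almost everywhere. -/
structure IsSolutionOn (q : ℝ → ℝ) (lam : ℂ) (a b : ℝ) (y dy : ℝ → ℂ) : Prop where
  hasDeriv : ∀ x ∈ Icc a b, HasDerivWithinAt y (dy x) (Icc a b) x
  absCont : AbsolutelyContinuousOnInterval dy a b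
  ode : ∀ᵐ x, x ∈ Icc a b → HasDerivAt dy (((q x : ℂ) - lam) * y x) x

/-- `(yL, yR)` is an eigenfunction, for the eigenvalue `lam`, of `-y'' + q y = lam y` on `[-S, S]`
with the transfer condition `(y(0+), y'(0+)) = M (y(0-), y'(0-))` and the boundary conditions
`y(-S) cos α - y'(-S) sin α = 0`, `y(S) cos β - y'(S) sin β = 0`.
Here `yL` is `y` on `[-S, 0)` and `yR` is `y` on `(0, S]`, each continued to `0` by its one-sided
limit (and likewise for the derivatives `dyL`, `dyR`), so that `yL 0 = y(0-)`, `yR 0 = y(0+)`. -/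
structure IsTransferEigenfunction (S : ℝ) (q : ℝ → ℝ) (M : Matrix (Fin 2) (Fin 2) ℝ) (α β : ℝ)
    (lam : ℂ) (yL dyL yR dyR : ℝ → ℂ) : Prop where
  left : IsSolutionOn q lam (-S) 0 yL dyL
  right : IsSolutionOn q lam 0 S yR dyR
  transfer_val : yR 0 = (M 0 0 : ℂ) * yL 0 + (M 0 1 : ℂ) * dyL 0
  transfer_deriv : dyR 0 = (M 1 0 : ℂ) * yL 0 + (M 1 1 : ℂ) * dyL 0
  bc_left : yL (-S) * (Real.cos α : ℂ) - dyL (-S) * (Real.sin α : ℂ) = 0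
  bc_right : yR S * (Real.cos β : ℂ) - dyR S * (Real.sin β : ℂ) = 0
  nontrivial : (∃ x ∈ Icc (-S) 0, yL x ≠ 0) ∨ (∃ x ∈ Icc 0 S, yR x ≠ 0)

/-- The spectrum of the transfer-condition problem on `[-S, S]`: the set of its eigenvalues. -/
def transferSpectrum (S : ℝ) (q : ℝ → ℝ) (M : Matrix (Fin 2) (Fin 2) ℝ) (α β : ℝ) : Set ℂ :=
  {lam | ∃ yL dyL yR dyR : ℝ → ℂ, IsTransferEigenfunction S q M α β lam yL dyL yR dyR}

/-! Let `y` solve the equation with data `(sin α, cos α)` at `-S`, carried through `0` by `M`. The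
characteristic function `F_β = y(S) cos β - y'(S) sin β` is entire in `lam`, grows at most like `exp
(C √|lam|)`, and its zeros are the spectrum. Since `q` and `M` are real and `det M > 0`, Lagrange's
identity bounds `|F_β|` below by `c |Im lam| exp (-C (1 + √|lam|))`
(`IsTransferFamily.exists_le_norm`). So all zeros are real and simple, and the quotient of the
characteristic functions of `q` and `r` is entire, zero-free and of order at most `1/2`, hence
constant (`exists_eq_const_mul_of_zeros`).

The constants for `β` and `β'` agree: along `lam = 2 i k²` both equal the limit of one quotient that
does not involve the angle. As `sin (β - β') ≠ 0`, the whole Cauchy data at `S` are then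
proportional with a factor independent of `lam` (`exists_cauchy_data_eq_const_mul`).

A Borg–Marchenko argument recovers the potential from such data
(`potential_ae_eq_of_cauchy_data_eq`). Let `(u₁, v₁)`, `(u₂, v₂)` be the fundamental systems of the
two potentials normalised at the right end. Then `u₁ v₂ - v₁ u₂` is entire of order at most `1/2`
and is `O(1/k)` on both imaginary half-axes, so it vanishes by Phragmén–Lindelöf and Liouville, and
this forces equal potentials. The argument is applied on `[0, S]`; equality there carries the
proportional data back to `0⁺`, the inverse of `M` carries them to `0⁻`, and the same argument
settles `[-S, 0]`. -/

section AbsolutelyContinuous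

/-! ### Absolutely continuous functions and Gronwall inequalities -/

open Filter Topology intervalIntegral

variable {a b : ℝ}

theorem LipschitzOnWith.comp_absolutelyContinuousOnInterval {X Y : Type*} [PseudoMetricSpace X]
    [PseudoMetricSpace Y] {f : ℝ → X} {g : X → Y} {K : NNReal} {s : Set X}
    (hg : LipschitzOnWith K g s) (hs : MapsTo f (uIcc a b) s)
    (hf : AbsolutelyContinuousOnInterval f a b) :
    AbsolutelyContinuousOnInterval (fun x => g (f x)) a b := by
  rw [absolutelyContinuousOnInterval_iff] at hf ⊢
  intro ε hε
  obtain ⟨δ, hδ, h⟩ := hf (ε / (K + 1)) (by positivity)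
  refine ⟨δ, hδ, fun E hE hE' => ?_⟩
  calc ∑ i ∈ Finset.range E.1, dist (g (f (E.2 i).1)) (g (f (E.2 i).2))
      ≤ ∑ i ∈ Finset.range E.1, (K : ℝ) * dist (f (E.2 i).1) (f (E.2 i).2) := by
        refine Finset.sum_le_sum fun i hi => hg.dist_le_mul _ (hs ?_) _ (hs ?_)
        · exact (hE.1 i hi).1
        · exact (hE.1 i hi).2
    _ = K * ∑ i ∈ Finset.range E.1, dist (f (E.2 i).1) (f (E.2 i).2) := by
        rw [Finset.mul_sum]
    _ ≤ K * (ε / (K + 1)) := by gcongr; exact (h E hE hE').le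
    _ < ε := by
        rw [← mul_div_assoc, div_lt_iff₀ (by positivity)]
        nlinarith

theorem LipschitzWith.comp_absolutelyContinuousOnInterval {X Y : Type*} [PseudoMetricSpace X]
    [PseudoMetricSpace Y] {f : ℝ → X} {g : X → Y} {K : NNReal} (hg : LipschitzWith K g)
    (hf : AbsolutelyContinuousOnInterval f a b) :
    AbsolutelyContinuousOnInterval (fun x => g (f x)) a b :=
  (hg.lipschitzOnWith (s := univ)).comp_absolutelyContinuousOnInterval (mapsTo_univ _ _) hf

namespace AbsolutelyContinuousOnInterval

theorem complex_im {f : ℝ → ℂ} (hf : AbsolutelyContinuousOnInterval f a b) :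
    AbsolutelyContinuousOnInterval (fun x => (f x).im) a b :=
  Complex.imCLM.lipschitz.comp_absolutelyContinuousOnInterval hf

theorem complex_ofReal {f : ℝ → ℝ} (hf : AbsolutelyContinuousOnInterval f a b) :
    AbsolutelyContinuousOnInterval (fun x => (f x : ℂ)) a b :=
  Complex.ofRealCLM.lipschitz.comp_absolutelyContinuousOnInterval hf

theorem complex_conj {f : ℝ → ℂ} (hf : AbsolutelyContinuousOnInterval f a b) :
    AbsolutelyContinuousOnInterval (fun x => (starRingEnd ℂ) (f x)) a b :=
  Complex.conjCLE.lipschitz.comp_absolutelyContinuousOnInterval hf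

theorem of_contDiff {E : Type*} [NormedAddCommGroup E] [NormedSpace ℝ E] {f : ℝ → E}
    (hf : ContDiff ℝ 1 f) : AbsolutelyContinuousOnInterval f a b :=
  hf.contDiffOn.absolutelyContinuousOnInterval

theorem cmul {f g : ℝ → ℂ} (hf : AbsolutelyContinuousOnInterval f a b)
    (hg : AbsolutelyContinuousOnInterval g a b) :
    AbsolutelyContinuousOnInterval (fun x => f x * g x) a b :=
  hf.fun_smul hg

theorem rmul {f g : ℝ → ℝ} (hf : AbsolutelyContinuousOnInterval f a b)
    (hg : AbsolutelyContinuousOnInterval g a b) :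
    AbsolutelyContinuousOnInterval (fun x => f x * g x) a b :=
  hf.fun_smul hg

theorem const {X : Type*} [NormedAddCommGroup X] [NormedSpace ℝ X] (c : X) :
    AbsolutelyContinuousOnInterval (fun _ : ℝ => c) a b :=
  of_contDiff contDiff_const

theorem exp {f : ℝ → ℝ} (hf : AbsolutelyContinuousOnInterval f a b) :
    AbsolutelyContinuousOnInterval (fun x => Real.exp (f x)) a b := by
  obtain ⟨C, hC⟩ := hf.exists_bound
  obtain ⟨K, hK⟩ := (Real.contDiff_exp (n := 1)).contDiffOn.exists_lipschitzOnWith (by decide)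
    (convex_Icc (-C) C) isCompact_Icc
  exact hK.comp_absolutelyContinuousOnInterval (fun x hx => abs_le.1 (hC x hx)) hf

theorem congr {X : Type*} [PseudoMetricSpace X] {f g : ℝ → X}
    (hf : AbsolutelyContinuousOnInterval f a b) (h : EqOn f g (uIcc a b)) :
    AbsolutelyContinuousOnInterval g a b := by
  rw [absolutelyContinuousOnInterval_iff] at hf ⊢
  intro ε hε
  obtain ⟨δ, hδ, H⟩ := hf ε hε
  refine ⟨δ, hδ, fun E hE hE' => ?_⟩
  convert H E hE hE' using 1
  refine Finset.sum_congr rfl fun i hi => ?_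
  rw [h (hE.1 i hi).1, h (hE.1 i hi).2]

theorem complex_integral {f : ℝ → ℂ} {c : ℝ} (hf : IntervalIntegrable f volume a b)
    (hc : c ∈ uIcc a b) : AbsolutelyContinuousOnInterval (fun x => ∫ t in c..x, f t) a b := by
  have hfr : IntervalIntegrable (fun t => (f t).re) volume a b := ⟨hf.1.re, hf.2.re⟩
  have hfi : IntervalIntegrable (fun t => (f t).im) volume a b := ⟨hf.1.im, hf.2.im⟩
  have h1 := (hfr.absolutelyContinuousOnInterval_intervalIntegral hc).complex_ofReal
  have h2 := (hfi.absolutelyContinuousOnInterval_intervalIntegral hc).complex_ofReal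
  refine (h1.add (h2.const_smul Complex.I)).congr fun x hx => ?_
  have hsub : uIcc c x ⊆ uIcc a b := uIcc_subset_uIcc hc hx
  have hr : IntervalIntegrable (fun t => ((f t).re : ℂ)) volume c x :=
    ⟨(hfr.mono_set hsub).1.ofReal, (hfr.mono_set hsub).2.ofReal⟩
  have hi : IntervalIntegrable (fun t => ((f t).im : ℂ)) volume c x :=
    ⟨(hfi.mono_set hsub).1.ofReal, (hfi.mono_set hsub).2.ofReal⟩
  have hi' : IntervalIntegrable (fun t => Complex.I • ((f t).im : ℂ)) volume c x :=
    hi.smul Complex.I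
  simp only [Pi.add_apply, ← intervalIntegral.integral_ofReal]
  rw [← intervalIntegral.integral_smul, ← intervalIntegral.integral_add hr hi']
  refine intervalIntegral.integral_congr fun t _ => ?_
  simp [mul_comm Complex.I, Complex.re_add_im]

theorem integral_eq_sub_of_ae_hasDerivAt {f f' : ℝ → ℂ}
    (hf : AbsolutelyContinuousOnInterval f a b) (hf' : IntervalIntegrable f' volume a b)
    (h : ∀ᵐ x, x ∈ uIcc a b → HasDerivAt f (f' x) x) : ∫ x in a..b, f' x = f b - f a := by
  have hg : AbsolutelyContinuousOnInterval (fun x => f x - ∫ t in a..x, f' t) a b :=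
    hf.sub (complex_integral hf' left_mem_uIcc)
  obtain ⟨C, hC⟩ := hg.const_of_ae_hasDerivAt_zero (by
    filter_upwards [h, hf'.ae_hasDerivAt_integral] with x h1 h2 h3
    simpa using (h1 h3).fun_sub (h2 h3 a left_mem_uIcc))
  have h1 := hC a left_mem_uIcc
  have h2 := hC b right_mem_uIcc
  simp only [intervalIntegral.integral_same, sub_zero] at h1 h2
  rw [h1, ← h2]; ring

theorem real_integral_eq_sub_of_ae_hasDerivAt {f f' : ℝ → ℝ}
    (hf : AbsolutelyContinuousOnInterval f a b)
    (h : ∀ᵐ x, x ∈ uIcc a b → HasDerivAt f (f' x) x) : ∫ x in a..b, f' x = f b - f a := by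
  rw [← hf.integral_deriv_eq_sub]
  refine intervalIntegral.integral_congr_ae ?_
  filter_upwards [h] with x hx hx'
  exact ((hx (uIoc_subset_uIcc hx')).deriv).symm

theorem le_of_ae_hasDerivAt_nonpos {f : ℝ → ℝ} (hab : a ≤ b)
    (hf : AbsolutelyContinuousOnInterval f a b)
    (h : ∀ᵐ x, x ∈ Icc a b → ∃ e ≤ 0, HasDerivAt f e x) : f b ≤ f a := by
  rw [← sub_nonpos, ← hf.integral_deriv_eq_sub, intervalIntegral.integral_of_le hab]
  refine integral_nonpos_of_ae ?_
  filter_upwards [ae_restrict_of_ae h, ae_restrict_mem measurableSet_Ioc] with x hx hx'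
  obtain ⟨e, he, hd⟩ := hx (Ioc_subset_Icc_self hx')
  simpa [hd.deriv] using he

/-- `E exp (-∫ g)` is absolutely continuous with nonpositive derivative almost everywhere, hence
does not increase. The coefficient is only integrable, which is why the differential inequality is
asked for almost everywhere. -/
theorem gronwall_le {E g : ℝ → ℝ} (hab : a ≤ b) (hE : AbsolutelyContinuousOnInterval E a b)
    (hg : IntervalIntegrable g volume a b)
    (h : ∀ᵐ x, x ∈ Icc a b → ∃ e ≤ g x * E x, HasDerivAt E e x) :
    E b ≤ E a * Real.exp (∫ x in a..b, g x) := by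
  have hG := hg.absolutelyContinuousOnInterval_intervalIntegral (c := a) left_mem_uIcc
  have hF := hE.rmul (hG.neg.exp)
  have key := hF.le_of_ae_hasDerivAt_nonpos hab (by
    filter_upwards [h, hg.ae_hasDerivAt_integral] with x h1 h2 h3
    obtain ⟨e, he, hd⟩ := h1 h3
    have h4 := h2 (by rwa [uIcc_of_le hab]) a left_mem_uIcc
    refine ⟨_, ?_, hd.mul (h4.neg.exp)⟩
    simp only [Pi.neg_apply]
    have := Real.exp_pos (-∫ v in a..x, g v)
    nlinarith)
  simp only [Pi.neg_apply, intervalIntegral.integral_same, neg_zero, Real.exp_zero, mul_one] at key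
  rw [Real.exp_neg, ← div_eq_mul_inv, div_le_iff₀ (Real.exp_pos _)] at key
  exact key

theorem le_gronwall {E g : ℝ → ℝ} (hab : a ≤ b) (hE : AbsolutelyContinuousOnInterval E a b)
    (hg : IntervalIntegrable g volume a b)
    (h : ∀ᵐ x, x ∈ Icc a b → ∃ e ≥ g x * E x, HasDerivAt E e x) :
    E a * Real.exp (∫ x in a..b, g x) ≤ E b := by
  have := hE.neg.gronwall_le hab hg (by
    filter_upwards [h] with x h1 h2
    obtain ⟨e, he, hd⟩ := h1 h2
    exact ⟨-e, by simp only [Pi.neg_apply]; linarith, hd.neg⟩)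
  simp only [Pi.neg_apply] at this
  linarith

theorem of_hasDerivWithinAt {f f' : ℝ → ℂ} (hab : a ≤ b)
    (h : ∀ x ∈ Icc a b, HasDerivWithinAt f (f' x) (Icc a b) x) (hf' : ContinuousOn f' (Icc a b)) :
    AbsolutelyContinuousOnInterval f a b := by
  obtain ⟨C, hC⟩ := isCompact_Icc.exists_bound_of_continuousOn hf'
  have := (convex_Icc a b).lipschitzOnWith_of_nnnorm_hasDerivWithin_le (C := C.toNNReal) h
    (fun x hx => by
      rw [← NNReal.coe_le_coe, coe_nnnorm]
      exact (hC x hx).trans (Real.le_coe_toNNReal C))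
  rw [← uIcc_of_le hab] at this
  exact this.absolutelyContinuousOnInterval

end AbsolutelyContinuousOnInterval

end AbsolutelyContinuous

/-! ### Solutions depending holomorphically on the spectral parameter -/

section Existence

open scoped BoundedContinuousFunction

/-- Conjugating by `w` plays the role of passing to an equivalent weighted norm, in which the
Neumann series of `v` converges. -/
theorem isUnit_one_sub_of_norm_conj_lt_one {A : Type*} [NormedRing A] [CompleteSpace A]
    {v w w' : A} (h : w * w' = 1) (h' : w' * w = 1) (hv : ‖w' * v * w‖ < 1) : IsUnit (1 - v) := by
  have e : 1 - v = w * (1 - w' * v * w) * w' := by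
    have : w * (1 - w' * v * w) * w' = w * w' - (w * w') * v * (w * w') := by noncomm_ring
    rw [this, h]; simp
  rw [e]
  have hw : IsUnit w := ⟨⟨w, w', h, h'⟩, rfl⟩
  have hw' : IsUnit w' := ⟨⟨w', w, h', h⟩, rfl⟩
  exact (hw.mul (isUnit_one_sub_of_norm_lt_one hv)).mul hw'

theorem isUnit_one_sub_mul_sub_smul {A : Type*} [NormedRing A] [NormedAlgebra ℂ A]
    [CompleteSpace A] {w w' u v : A} {lam : ℂ} (h : w * w' = 1) (h' : w' * w = 1)
    (hu : ‖w' * u * w‖ ≤ 1 / (2 + ‖lam‖)) (hv : ‖w' * v * w‖ ≤ 1 / (2 + ‖lam‖)) :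
    IsUnit (1 - u * (v - lam • u)) := by
  refine isUnit_one_sub_of_norm_conj_lt_one h h' ?_
  have e : w' * (u * (v - lam • u)) * w =
      (w' * u * w) * (w' * v * w - lam • (w' * u * w)) := by
    have : w' * (u * (v - lam • u)) * w = w' * u * (w * w') * ((v - lam • u) * w) := by
      rw [h]; noncomm_ring
    rw [this]
    simp only [mul_assoc, mul_sub, sub_mul, smul_mul_assoc, mul_smul_comm]
  rw [e]
  calc _ ≤ ‖w' * u * w‖ * (‖w' * v * w‖ + ‖lam‖ * ‖w' * u * w‖) := by
        refine (norm_mul_le _ _).trans ?_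
        gcongr
        refine (norm_sub_le _ _).trans ?_
        rw [norm_smul]
    _ ≤ 1 / (2 + ‖lam‖) * (1 / (2 + ‖lam‖) + ‖lam‖ * (1 / (2 + ‖lam‖))) := by gcongr
    _ < 1 := by
        have : 0 ≤ ‖lam‖ := norm_nonneg _
        have h3 : 1 / (2 + ‖lam‖) * (1 / (2 + ‖lam‖) + ‖lam‖ * (1 / (2 + ‖lam‖))) =
          (1 + ‖lam‖) / (2 + ‖lam‖) ^ 2 := by field_simp
        rw [h3, div_lt_one (by positivity)]
        nlinarith

theorem differentiable_inverse_one_sub_mul_sub_smul {A : Type*} [NormedRing A] [NormedAlgebra ℂ A]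
    [CompleteSpace A] {u v : A} (h : ∀ lam : ℂ, IsUnit (1 - u * (v - lam • u))) :
    Differentiable ℂ (fun lam : ℂ => Ring.inverse (1 - u * (v - lam • u))) := by
  intro lam
  have h1 : DifferentiableAt ℂ (fun lam : ℂ => 1 - u * (v - lam • u)) lam := by fun_prop
  exact (differentiableAt_inverse (𝕜 := ℂ) (h lam)).comp lam h1

theorem Integrable.mul_boundedContinuous {g : ℝ → ℂ} (hg : Integrable g) (y : ℝ →ᵇ ℂ) :
    Integrable (fun t => g t * y t) :=
  hg.mul_bdd y.continuous.aestronglyMeasurable (Filter.Eventually.of_forall y.norm_coe_le_norm)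

/-- The Volterra operator `y ↦ ∫ t in a..x, g t * y t` on bounded continuous functions. -/
noncomputable def volterra (a : ℝ) (g : ℝ → ℂ) (hg : Integrable g) :
    (ℝ →ᵇ ℂ) →L[ℂ] (ℝ →ᵇ ℂ) :=
  have bound : ∀ (y : ℝ →ᵇ ℂ) (x : ℝ), ‖∫ t in a..x, g t * y t‖ ≤ (∫ t, ‖g t‖) * ‖y‖ := by
    intro y x
    have hi := (hg.norm.mul_const ‖y‖)
    rw [← integral_mul_const]
    refine intervalIntegral.norm_integral_le_integral_norm_uIoc.trans ?_
    refine (setIntegral_mono ((Integrable.mul_boundedContinuous hg y).norm.integrableOn)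
      hi.integrableOn fun t => ?_).trans
      (setIntegral_le_integral hi (Filter.Eventually.of_forall fun t => by positivity))
    rw [norm_mul]
    gcongr
    exact y.norm_coe_le_norm t
  LinearMap.mkContinuous
    { toFun := fun y => BoundedContinuousFunction.ofNormedAddCommGroup
        (fun x => ∫ t in a..x, g t * y t)
        (intervalIntegral.continuous_primitive
          (fun _ _ => (Integrable.mul_boundedContinuous hg y).intervalIntegrable) a)
        ((∫ t, ‖g t‖) * ‖y‖) (bound y)
      map_add' := fun y z => by
        ext x
        simp only [BoundedContinuousFunction.coe_ofNormedAddCommGroup,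
          BoundedContinuousFunction.coe_add, Pi.add_apply, mul_add]
        exact intervalIntegral.integral_add
          (Integrable.mul_boundedContinuous hg y).intervalIntegrable
          (Integrable.mul_boundedContinuous hg z).intervalIntegrable
      map_smul' := fun c y => by
        ext x
        simp only [BoundedContinuousFunction.coe_ofNormedAddCommGroup,
          BoundedContinuousFunction.coe_smul, smul_eq_mul, RingHom.id_apply]
        rw [← intervalIntegral.integral_const_mul]
        congr 1; ext t; ring }
    (∫ t, ‖g t‖)
    (fun y => BoundedContinuousFunction.norm_ofNormedAddCommGroup_le _
      (mul_nonneg (integral_nonneg fun _ => norm_nonneg _) (norm_nonneg _)) (bound y))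

theorem volterra_apply {a : ℝ} {g : ℝ → ℂ} (hg : Integrable g) (y : ℝ →ᵇ ℂ) (x : ℝ) :
    volterra a g hg y x = ∫ t in a..x, g t * y t := rfl

theorem integral_mul_exp_primitive_le {a x N : ℝ} {m : ℝ → ℝ} (hm : Integrable m) (hN : 0 < N) :
    ∫ t in a..x, m t * Real.exp (N * ∫ s in a..t, m s) ≤
      Real.exp (N * ∫ s in a..x, m s) / N := by
  have hG := (hm.intervalIntegrable (a := a) (b := x)).absolutelyContinuousOnInterval_intervalIntegral
    (c := a) left_mem_uIcc
  have h := ((hG.const_mul N).exp.const_mul N⁻¹).real_integral_eq_sub_of_ae_hasDerivAt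
    (f' := fun t => m t * Real.exp (N * ∫ s in a..t, m s)) (by
      filter_upwards [(hm.intervalIntegrable (a := a) (b := x)).ae_hasDerivAt_integral] with t h1 h2
      have h3 := ((h1 h2 a left_mem_uIcc).const_mul N).exp.const_mul N⁻¹
      rwa [mul_comm (Real.exp _), mul_assoc N, inv_mul_cancel_left₀ hN.ne'] at h3)
  rw [h, div_eq_inv_mul]
  have : 0 ≤ N⁻¹ * Real.exp (N * ∫ s in a..a, m s) := by positivity
  linarith

/-- The weight is multiplication by `exp (N ρ)` with `ρ = ∫ m`, as in Bielecki's norm. For a kernel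
dominated by `m`, the conjugated Volterra operator is bounded by `exp (-N ρ) ∫ m exp (N ρ) ≤ 1 / N`.
To the left of `a` nothing is integrated, as `g` vanishes there. -/
theorem exists_weight (a : ℝ) {m : ℝ → ℝ} (hm : Integrable m) (hm0 : ∀ t, 0 ≤ m t)
    {N : ℝ} (hN : 0 < N) :
    ∃ w w' : (ℝ →ᵇ ℂ) →L[ℂ] (ℝ →ᵇ ℂ), w * w' = 1 ∧ w' * w = 1 ∧
      ∀ (g : ℝ → ℂ) (hg : Integrable g), (∀ t, ‖g t‖ ≤ m t) → (∀ t < a, g t = 0) →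
        ‖w' * volterra a g hg * w‖ ≤ 1 / N := by
  set ρ : ℝ → ℝ := fun x => ∫ s in a..x, m s with hρ
  have hρc : Continuous ρ := intervalIntegral.continuous_primitive
    (fun _ _ => hm.intervalIntegrable) a
  have hρb : ∀ x, |ρ x| ≤ ∫ s, m s := by
    intro x
    refine (intervalIntegral.norm_integral_le_integral_norm_uIoc (f := m)).trans ?_
    simp only [Real.norm_eq_abs, abs_of_nonneg (hm0 _)]
    exact setIntegral_le_integral hm (Filter.Eventually.of_forall hm0)
  have hbound : ∀ c : ℝ, ∀ x, ‖((Real.exp (c * ρ x) : ℝ) : ℂ)‖ ≤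
      Real.exp (|c| * ∫ s, m s) := by
    intro c x
    rw [Complex.norm_real, Real.norm_eq_abs, Real.abs_exp, Real.exp_le_exp]
    calc c * ρ x ≤ |c * ρ x| := le_abs_self _
      _ = |c| * |ρ x| := abs_mul _ _
      _ ≤ _ := by gcongr; exact hρb x
  let e : ℝ → (ℝ →ᵇ ℂ) := fun c => BoundedContinuousFunction.ofNormedAddCommGroup
    (fun x => ((Real.exp (c * ρ x) : ℝ) : ℂ)) (by fun_prop) _ (hbound c)
  have he : ∀ c x, e c x = ((Real.exp (c * ρ x) : ℝ) : ℂ) := fun c x => rfl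
  have hee : ∀ c, e c * e (-c) = 1 := by
    intro c
    ext x
    rw [BoundedContinuousFunction.mul_apply, he, he, ← Complex.ofReal_mul, ← Real.exp_add]
    simp
  refine ⟨ContinuousLinearMap.mul ℂ _ (e N), ContinuousLinearMap.mul ℂ _ (e (-N)), ?_, ?_, ?_⟩
  · ext y x
    simp only [ContinuousLinearMap.mul_apply', mul_apply_eq_comp,
      one_apply_eq_self, ← mul_assoc, hee, one_mul]
  · ext y x
    have : e (-N) * e N = 1 := by rw [mul_comm, hee]
    simp only [ContinuousLinearMap.mul_apply', mul_apply_eq_comp,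
      one_apply_eq_self, ← mul_assoc, this, one_mul]
  · intro g hg hgm hga
    refine ContinuousLinearMap.opNorm_le_bound _ (by positivity) fun y => ?_
    rw [BoundedContinuousFunction.norm_le (by positivity)]
    intro x
    simp only [ContinuousLinearMap.mul_apply', mul_apply_eq_comp,
      BoundedContinuousFunction.mul_apply, volterra_apply, he, norm_mul, Complex.norm_real,
      Real.norm_eq_abs, Real.abs_exp]
    rcases le_or_gt a x with hax | hxa
    · have h1 : ‖∫ t in a..x, g t * (((Real.exp (N * ρ t) : ℝ) : ℂ) * y t)‖ ≤
          ∫ t in a..x, (m t * Real.exp (N * ρ t)) * ‖y‖ := by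
        refine intervalIntegral.norm_integral_le_of_norm_le hax
          (Filter.Eventually.of_forall fun t _ => ?_) ?_
        · rw [norm_mul, norm_mul, Complex.norm_real, Real.norm_eq_abs, Real.abs_exp, ← mul_assoc]
          gcongr
          · exact mul_nonneg (hm0 t) (Real.exp_nonneg _)
          · exact hgm t
          · exact y.norm_coe_le_norm t
        · exact ((hm.intervalIntegrable (a := a) (b := x)).mul_continuousOn
            (by fun_prop)).mul_const _
      rw [intervalIntegral.integral_mul_const] at h1
      have h2 := integral_mul_exp_primitive_le (a := a) (x := x) hm hN
      calc _ ≤ Real.exp (-N * ρ x) * (Real.exp (N * ρ x) / N * ‖y‖) := by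
            gcongr
            exact h1.trans (by gcongr)
        _ = Real.exp (-N * ρ x) * Real.exp (N * ρ x) * (1 / N * ‖y‖) := by ring
        _ = 1 / N * ‖y‖ := by rw [← Real.exp_add]; simp
    · have : ∫ t in a..x, g t * (((Real.exp (N * ρ t) : ℝ) : ℂ) * y t) = 0 := by
        rw [intervalIntegral.integral_symm, intervalIntegral.integral_of_le hxa.le,
          integral_Ioc_eq_integral_Ioo, setIntegral_congr_fun measurableSet_Ioo
            (g := fun _ => (0 : ℂ)) (fun t ht => by simp [hga t ht.2])]
        simp
      rw [this]; simp only [norm_zero, mul_zero]; positivity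

/-- With `J₁`, `J₂` integrating `y` and `q y` from `a`, the initial value problem reads `y = u₀ + J₁
y'` and `y' = u₁ + (J₂ - lam J₁) y`. Eliminating `y'` leaves `(1 - J₁ (J₂ - lam J₁)) y = u₀ + u₁ J₁
1`. The operator is invertible for every `lam` in a suitably weighted norm, and its inverse is
holomorphic in `lam`. The coefficients are cut off to `[a, b]` so that one Banach space of functions
on `ℝ` serves. -/
theorem exists_isSolutionOn_differentiable {q : ℝ → ℝ} {a b : ℝ} (hab : a ≤ b)
    (hq : IntervalIntegrable q volume a b) (u₀ u₁ : ℂ) :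
    ∃ y dy : ℂ → ℝ → ℂ,
      (∀ lam, IsSolutionOn q lam a b (y lam) (dy lam) ∧ y lam a = u₀ ∧ dy lam a = u₁) ∧
      ∀ x, Differentiable ℂ (fun lam => y lam x) ∧ Differentiable ℂ (fun lam => dy lam x) := by
  have hqI : IntegrableOn q (Icc a b) := by
    rwa [intervalIntegrable_iff_integrableOn_Icc_of_le hab] at hq
  set g₁ : ℝ → ℂ := (Icc a b).indicator 1 with hg₁
  set g₂ : ℝ → ℂ := (Icc a b).indicator (fun t => (q t : ℂ)) with hg₂
  -- A common majorant of both kernels, so that a single weight handles `J₁` and `J₂`.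
  set m : ℝ → ℝ := (Icc a b).indicator (fun t => 1 + |q t|) with hm
  have i₁ : Integrable g₁ := (integrable_indicator_iff measurableSet_Icc).2
    (integrableOn_const (by simp))
  have i₂ : Integrable g₂ := (integrable_indicator_iff measurableSet_Icc).2 hqI.ofReal
  have im : Integrable m := (integrable_indicator_iff measurableSet_Icc).2
    ((integrableOn_const (by simp)).add hqI.abs)
  have hm0 : ∀ t, 0 ≤ m t := fun t => indicator_nonneg (fun _ _ => by positivity) t
  have b₁ : ∀ t, ‖g₁ t‖ ≤ m t := fun t => by
    by_cases ht : t ∈ Icc a b <;> simp [g₁, m, ht]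
  have b₂ : ∀ t, ‖g₂ t‖ ≤ m t := fun t => by
    by_cases ht : t ∈ Icc a b <;> simp [g₂, m, ht]
  have z₁ : ∀ t < a, g₁ t = 0 := fun t ht => by
    simp [g₁, not_le.2 ht]
  have z₂ : ∀ t < a, g₂ t = 0 := fun t ht => by
    simp [g₂, not_le.2 ht]
  set J₁ := volterra a g₁ i₁ with hJ₁
  set J₂ := volterra a g₂ i₂ with hJ₂
  have unit : ∀ lam : ℂ, IsUnit (1 - J₁ * (J₂ - lam • J₁)) := by
    intro lam
    obtain ⟨w, w', hw, hw', H⟩ := exists_weight a im hm0 (N := 2 + ‖lam‖) (by positivity)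
    exact isUnit_one_sub_mul_sub_smul (A := (ℝ →ᵇ ℂ) →L[ℂ] (ℝ →ᵇ ℂ)) hw hw' (H g₁ i₁ b₁ z₁)
      (H g₂ i₂ b₂ z₂)
  set f : ℝ →ᵇ ℂ := u₀ • 1 + u₁ • J₁ 1 with hf
  set Y : ℂ → (ℝ →ᵇ ℂ) := fun lam => Ring.inverse (1 - J₁ * (J₂ - lam • J₁)) f with hY
  set Z : ℂ → (ℝ →ᵇ ℂ) := fun lam => u₁ • 1 + (J₂ - lam • J₁) (Y lam) with hZ
  have eqY : ∀ lam, Y lam = u₀ • 1 + J₁ (Z lam) := by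
    intro lam
    have h1 : (1 - J₁ * (J₂ - lam • J₁)) (Y lam) = f := by
      rw [hY]
      change ((1 - J₁ * (J₂ - lam • J₁)) * Ring.inverse (1 - J₁ * (J₂ - lam • J₁))) f = f
      rw [Ring.mul_inverse_cancel _ (unit lam)]; rfl
    have h2 : Y lam - J₁ ((J₂ - lam • J₁) (Y lam)) = f := h1
    rw [sub_eq_iff_eq_add] at h2
    rw [h2]
    simp only [hZ, hf, map_add, map_smul, add_assoc]
  have dJ : Differentiable ℂ (fun lam : ℂ => J₂ - lam • J₁) :=
    (differentiable_const _).sub (differentiable_id.smul_const J₁)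
  have dY : Differentiable ℂ Y :=
    (differentiable_inverse_one_sub_mul_sub_smul (A := (ℝ →ᵇ ℂ) →L[ℂ] (ℝ →ᵇ ℂ)) unit).clm_apply
      (differentiable_const f)
  have dZ : Differentiable ℂ Z := (differentiable_const _).add (dJ.clm_apply dY)
  have iy : ∀ lam, Integrable (fun t => g₂ t * Y lam t - lam * (g₁ t * Y lam t)) := fun lam =>
    (Integrable.mul_boundedContinuous i₂ _).sub ((Integrable.mul_boundedContinuous i₁ _).const_mul _)
  have eZ : ∀ lam, (fun x => Z lam x) =
      fun x => u₁ + ∫ t in a..x, (g₂ t * Y lam t - lam * (g₁ t * Y lam t)) := by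
    intro lam
    ext x
    rw [intervalIntegral.integral_sub (Integrable.mul_boundedContinuous i₂ _).intervalIntegrable
      ((Integrable.mul_boundedContinuous i₁ _).const_mul _).intervalIntegrable,
      intervalIntegral.integral_const_mul]
    simp [hZ, hJ₁, hJ₂, volterra_apply]
  refine ⟨fun lam x => Y lam x, fun lam x => Z lam x, fun lam => ⟨⟨?_, ?_, ?_⟩, ?_, ?_⟩, ?_⟩
  · intro x hx
    have h1 : HasDerivWithinAt (fun x => u₀ + ∫ t in a..x, Z lam t) (Z lam x) (Icc a b) x :=
      ((((Z lam).continuous.integral_hasStrictDerivAt a x).hasDerivAt).const_add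
        u₀).hasDerivWithinAt
    refine h1.congr_of_mem (fun z hz => ?_) hx
    simp only [eqY]
    simp only [BoundedContinuousFunction.coe_add, BoundedContinuousFunction.coe_smul,
      Pi.add_apply, BoundedContinuousFunction.coe_one, Pi.one_apply, smul_eq_mul, mul_one,
      hJ₁, volterra_apply]
    congr 1
    refine intervalIntegral.integral_congr fun t ht => ?_
    rw [uIcc_of_le hz.1] at ht
    have : t ∈ Icc a b := ⟨ht.1, ht.2.trans hz.2⟩
    simp [g₁, this]
  · change AbsolutelyContinuousOnInterval (fun x => Z lam x) a b
    rw [eZ lam]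
    exact (AbsolutelyContinuousOnInterval.const u₁).add
      (AbsolutelyContinuousOnInterval.complex_integral (iy lam).intervalIntegrable left_mem_uIcc)
  · change ∀ᵐ x, x ∈ Icc a b → HasDerivAt (fun x => Z lam x) ((q x - lam) * Y lam x) x
    rw [eZ lam]
    filter_upwards [LocallyIntegrable.ae_hasDerivAt_integral (iy lam).locallyIntegrable] with x h1 h2
    have h3 := (h1 a).const_add u₁
    have e : ((q x : ℂ) - lam) * Y lam x = g₂ x * Y lam x - lam * (g₁ x * Y lam x) := by
      simp [g₁, g₂, h2]; ring
    rw [e]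
    exact h3
  · simp [eqY, hJ₁, volterra_apply]
  · simp [hZ, hJ₁, hJ₂, volterra_apply]
  · intro x
    have e := (BoundedContinuousFunction.evalCLM ℂ x : (ℝ →ᵇ ℂ) →L[ℂ] ℂ).differentiable
    exact ⟨e.comp dY, e.comp dZ⟩

end Existence

/-! ### Wronskian, Lagrange identity and growth of order one half -/

namespace IsSolutionOn

open AbsolutelyContinuousOnInterval ComplexConjugate

variable {q r : ℝ → ℝ} {lam : ℂ} {a b : ℝ} {y dy z dz : ℝ → ℂ}

theorem mono {c d : ℝ} (hy : IsSolutionOn q lam a b y dy) (hac : a ≤ c) (hcd : c ≤ d)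
    (hdb : d ≤ b) : IsSolutionOn q lam c d y dy := by
  have hs : Icc c d ⊆ Icc a b := Icc_subset_Icc hac hdb
  refine ⟨fun x hx => (hy.hasDeriv x (hs hx)).mono hs, hy.absCont.mono ?_, ?_⟩
  · rwa [uIcc_of_le hcd, uIcc_of_le (hac.trans (hcd.trans hdb))]
  · filter_upwards [hy.ode] with x h1 h2 using h1 (hs h2)

theorem congr_potential (hy : IsSolutionOn q lam a b y dy)
    (h : ∀ᵐ x, x ∈ Icc a b → q x = r x) : IsSolutionOn r lam a b y dy := by
  refine ⟨hy.hasDeriv, hy.absCont, ?_⟩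
  filter_upwards [hy.ode, h] with x h1 h2 h3
  rw [← h2 h3]; exact h1 h3

theorem continuousOn_deriv (hab : a ≤ b) (hy : IsSolutionOn q lam a b y dy) :
    ContinuousOn dy (Icc a b) := by
  have := hy.absCont.continuousOn
  rwa [uIcc_of_le hab] at this

theorem continuousOn (hy : IsSolutionOn q lam a b y dy) : ContinuousOn y (Icc a b) :=
  fun x hx => (hy.hasDeriv x hx).continuousWithinAt

theorem absCont_self (hab : a ≤ b) (hy : IsSolutionOn q lam a b y dy) :
    AbsolutelyContinuousOnInterval y a b :=
  of_hasDerivWithinAt hab hy.hasDeriv (hy.continuousOn_deriv hab)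

theorem ae_hasDerivAt (hy : IsSolutionOn q lam a b y dy) :
    ∀ᵐ x, x ∈ Icc a b → HasDerivAt y (dy x) x ∧ HasDerivAt dy (((q x : ℂ) - lam) * y x) x := by
  have ha : ∀ᵐ x : ℝ, x ≠ a := by simp [ae_iff]
  have hb : ∀ᵐ x : ℝ, x ≠ b := by simp [ae_iff]
  filter_upwards [hy.ode, ha, hb] with x h1 h2 h3 h4
  exact ⟨(hy.hasDeriv x h4).hasDerivAt
    (Icc_mem_nhds (lt_of_le_of_ne h4.1 h2.symm) (lt_of_le_of_ne h4.2 h3)), h1 h4⟩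

theorem add (hy : IsSolutionOn q lam a b y dy) (hz : IsSolutionOn q lam a b z dz) :
    IsSolutionOn q lam a b (fun x => y x + z x) (fun x => dy x + dz x) := by
  refine ⟨fun x hx => (hy.hasDeriv x hx).fun_add (hz.hasDeriv x hx), hy.absCont.add hz.absCont, ?_⟩
  filter_upwards [hy.ode, hz.ode] with x h1 h2 h3
  rw [mul_add]
  exact (h1 h3).fun_add (h2 h3)

theorem const_mul (c : ℂ) (hy : IsSolutionOn q lam a b y dy) :
    IsSolutionOn q lam a b (fun x => c * y x) (fun x => c * dy x) := by
  refine ⟨fun x hx => (hy.hasDeriv x hx).const_mul c, hy.absCont.const_smul c, ?_⟩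
  filter_upwards [hy.ode] with x h1 h2
  rw [mul_left_comm]
  exact (h1 h2).const_mul c

theorem wronskian_eq (hab : a ≤ b) (hy : IsSolutionOn q lam a b y dy)
    (hz : IsSolutionOn q lam a b z dz) {x : ℝ} (hx : x ∈ Icc a b) :
    y x * dz x - dy x * z x = y a * dz a - dy a * z a := by
  have hW : AbsolutelyContinuousOnInterval (fun x => y x * dz x - dy x * z x) a b :=
    ((hy.absCont_self hab).cmul hz.absCont).sub (hy.absCont.cmul (hz.absCont_self hab))
  obtain ⟨C, hC⟩ := hW.const_of_ae_hasDerivAt_zero (by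
    rw [uIcc_of_le hab]
    filter_upwards [hy.ae_hasDerivAt, hz.ae_hasDerivAt] with x h1 h2 h3
    obtain ⟨h4, h5⟩ := h1 h3
    obtain ⟨h6, h7⟩ := h2 h3
    have h8 := (h4.fun_mul h7).fun_sub (h5.fun_mul h6)
    have e : dy x * dz x + y x * (((q x : ℂ) - lam) * z x) -
        (((q x : ℂ) - lam) * y x * z x + dy x * dz x) = 0 := by ring
    rwa [e] at h8)
  rw [uIcc_of_le hab] at hC
  exact (hC x hx).trans (hC a (left_mem_Icc.2 hab)).symm

/-- Lagrange's identity for `y` and its conjugate: `|y'|²` and `q |y|²` are real, so only `Im lam`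
survives in the derivative. -/
theorem im_conj_mul_deriv_sub (hab : a ≤ b) (hy : IsSolutionOn q lam a b y dy) :
    (conj (y b) * dy b).im - (conj (y a) * dy a).im = - lam.im * ∫ x in a..b, ‖y x‖ ^ 2 := by
  rw [← intervalIntegral.integral_const_mul]
  refine (real_integral_eq_sub_of_ae_hasDerivAt
    (f := fun x => (conj (y x) * dy x).im) ?_ ?_).symm
  · exact ((hy.absCont_self hab).complex_conj.cmul hy.absCont).complex_im
  · rw [uIcc_of_le hab]
    filter_upwards [hy.ae_hasDerivAt] with x h1 h2
    obtain ⟨h3, h4⟩ := h1 h2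
    have h5 : HasDerivAt (fun x => (conj (y x) * dy x).im)
        (conj (dy x) * dy x + conj (y x) * (((q x : ℂ) - lam) * y x)).im x :=
      Complex.imCLM.hasFDerivAt.comp_hasDerivAt x (h3.star.fun_mul h4)
    have e : (conj (dy x) * dy x + conj (y x) * (((q x : ℂ) - lam) * y x)).im =
        -lam.im * ‖y x‖ ^ 2 := by
      rw [← Complex.normSq_eq_norm_sq, Complex.normSq_apply]
      simp only [Complex.add_im, Complex.mul_im, Complex.mul_re, Complex.conj_re, Complex.conj_im,
        Complex.sub_re, Complex.sub_im, Complex.ofReal_re, Complex.ofReal_im]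
      ring
    rwa [e] at h5

theorem norm_sq_absCont (hf : AbsolutelyContinuousOnInterval y a b) :
    AbsolutelyContinuousOnInterval (fun x => ‖y x‖ ^ 2) a b := by
  have h := lipschitzWith_one_norm.comp_absolutelyContinuousOnInterval hf
  refine (h.rmul h).congr fun x _ => ?_
  simp [sq]

theorem norm_add_norm_sq_le {A B : ℝ} : (A + B) ^ 2 ≤ 2 * (A ^ 2 + B ^ 2) := by
  nlinarith [sq_nonneg (A - B)]

/-- Gronwall for the energy `ω² |y|² + |y'|²` with `ω = 1 + √|lam|`. The weight `ω²` balances the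
two terms containing `lam`, so the energy changes at relative rate at most `2 ω + |q|`; this is the
source of order `1/2`. -/
theorem exists_norm_le (hab : a ≤ b) (hq : IntervalIntegrable q volume a b) :
    ∃ C > 0, ∀ (lam : ℂ) (y dy : ℝ → ℂ), IsSolutionOn q lam a b y dy →
      ∀ x ∈ Icc a b, ∀ x' ∈ Icc a b,
        ‖y x'‖ + ‖dy x'‖ ≤ (‖y x‖ + ‖dy x‖) * Real.exp (C * (1 + √‖lam‖)) := by
  set Q := ∫ x in a..b, |q x| with hQ
  have hQ0 : 0 ≤ Q := intervalIntegral.integral_nonneg hab fun _ _ => abs_nonneg _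
  -- `(b - a) + Q` comes from the Gronwall exponent. The extra `2` absorbs the factor `2 ω²` lost in
  -- passing between the energy and the norms, through `2 ω² ≤ exp (4 ω)`.
  refine ⟨(b - a) + Q + 2, by linarith, fun lam y dy hy x hx x' hx' => ?_⟩
  set ω := 1 + √‖lam‖ with hω
  have hω1 : 1 ≤ ω := by rw [hω]; linarith [Real.sqrt_nonneg ‖lam‖]
  have hlam : ‖lam‖ ≤ ω ^ 2 := by
    have := Real.sq_sqrt (norm_nonneg lam)
    rw [hω]; nlinarith [Real.sqrt_nonneg ‖lam‖]
  set E : ℝ → ℝ := fun x => ω ^ 2 * ‖y x‖ ^ 2 + ‖dy x‖ ^ 2 with hE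
  have hE0 : ∀ x, 0 ≤ E x := fun x => by positivity
  have hEac : AbsolutelyContinuousOnInterval E a b :=
    ((norm_sq_absCont (hy.absCont_self hab)).const_mul (ω ^ 2)).add (norm_sq_absCont hy.absCont)
  have hder : ∀ᵐ x, x ∈ Icc a b → ∃ e, HasDerivAt E e x ∧ |e| ≤ (2 * ω + |q x|) * E x := by
    filter_upwards [hy.ae_hasDerivAt] with x h1 h2
    obtain ⟨h3, h4⟩ := h1 h2
    refine ⟨_, (h3.norm_sq.const_mul (ω ^ 2)).add h4.norm_sq, ?_⟩
    have i1 := abs_real_inner_le_norm (y x) (dy x)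
    have i2 := abs_real_inner_le_norm (dy x) (((q x : ℂ) - lam) * y x)
    have i3 : ‖((q x : ℂ) - lam) * y x‖ ≤ (|q x| + ω ^ 2) * ‖y x‖ := by
      rw [norm_mul]
      gcongr
      refine (norm_sub_le _ _).trans ?_
      rw [Complex.norm_real, Real.norm_eq_abs]
      linarith
    have i4 : ‖dy x‖ * ‖((q x : ℂ) - lam) * y x‖ ≤ ‖dy x‖ * ((|q x| + ω ^ 2) * ‖y x‖) := by gcongr
    have i5 : 2 * ω * (‖y x‖ * ‖dy x‖) ≤ E x := by
      simp only [hE]; nlinarith [sq_nonneg (ω * ‖y x‖ - ‖dy x‖)]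
    have i6 : 2 * (‖y x‖ * ‖dy x‖) ≤ E x := by
      have : 0 ≤ ‖y x‖ * ‖dy x‖ := by positivity
      nlinarith
    calc _ ≤ ω ^ 2 * (2 * (‖y x‖ * ‖dy x‖)) + 2 * (‖dy x‖ * ((|q x| + ω ^ 2) * ‖y x‖)) := by
          refine (abs_add_le _ _).trans ?_
          rw [abs_mul, abs_mul, abs_mul, abs_of_nonneg (sq_nonneg ω), abs_two]
          have := i2.trans i4
          gcongr
      _ = 2 * ω * (2 * ω * (‖y x‖ * ‖dy x‖)) + |q x| * (2 * (‖y x‖ * ‖dy x‖)) := by ring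
      _ ≤ 2 * ω * E x + |q x| * E x := by gcongr
      _ = _ := by ring
  have hgi : IntervalIntegrable (fun x => 2 * ω + |q x|) volume a b :=
    intervalIntegrable_const.add hq.abs
  have hgI : ∀ c ∈ Icc a b, ∀ d ∈ Icc a b, c ≤ d →
      ∫ x in c..d, (2 * ω + |q x|) ≤ 2 * ω * (b - a) + Q := by
    intro c hc d hd hcd
    calc _ ≤ ∫ x in a..b, (2 * ω + |q x|) :=
          intervalIntegral.integral_mono_interval hc.1 hcd hd.2
            (Filter.Eventually.of_forall fun x => by simp only [Pi.zero_apply]; positivity) hgi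
      _ = _ := by
          rw [intervalIntegral.integral_add intervalIntegrable_const hq.abs,
            intervalIntegral.integral_const, smul_eq_mul]
          ring
  have main : E x' ≤ E x * Real.exp (2 * ω * (b - a) + Q) := by
    rcases le_total x x' with h | h
    · have hs : uIcc x x' ⊆ uIcc a b := by
        rw [uIcc_of_le h, uIcc_of_le hab]; exact Icc_subset_Icc hx.1 hx'.2
      refine ((hEac.mono hs).gronwall_le h (hgi.mono_set hs) ?_).trans ?_
      · filter_upwards [hder] with t h1 h2
        obtain ⟨e, h3, h4⟩ := h1 ⟨hx.1.trans h2.1, h2.2.trans hx'.2⟩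
        exact ⟨e, (le_abs_self e).trans h4, h3⟩
      · have := hgI x hx x' hx' h
        have := hE0 x
        gcongr
    · have hs : uIcc x' x ⊆ uIcc a b := by
        rw [uIcc_of_le h, uIcc_of_le hab]; exact Icc_subset_Icc hx'.1 hx.2
      have key := (hEac.mono hs).le_gronwall (g := fun x => -(2 * ω + |q x|)) h
        (hgi.mono_set hs).neg (by
          filter_upwards [hder] with t h1 h2
          obtain ⟨e, h3, h4⟩ := h1 ⟨hx'.1.trans h2.1, h2.2.trans hx.2⟩
          exact ⟨e, by have := neg_abs_le e; simp only [ge_iff_le]; linarith, h3⟩)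
      rw [intervalIntegral.integral_neg, Real.exp_neg, ← div_eq_mul_inv,
        div_le_iff₀ (Real.exp_pos _)] at key
      refine key.trans ?_
      have := hgI x' hx' x hx h
      have := hE0 x
      gcongr
  have h1 : (‖y x'‖ + ‖dy x'‖) ^ 2 ≤ 2 * E x' := by
    refine norm_add_norm_sq_le.trans ?_
    simp only [hE]
    have : ‖y x'‖ ^ 2 ≤ ω ^ 2 * ‖y x'‖ ^ 2 := by
      refine le_mul_of_one_le_left (by positivity) ?_; nlinarith
    linarith
  have h2 : E x ≤ (ω * (‖y x‖ + ‖dy x‖)) ^ 2 := by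
    simp only [hE]
    have : ‖dy x‖ ^ 2 ≤ ω ^ 2 * ‖dy x‖ ^ 2 := by
      refine le_mul_of_one_le_left (by positivity) ?_; nlinarith
    have : 0 ≤ ω ^ 2 * (‖y x‖ * ‖dy x‖) := by positivity
    nlinarith
  have h3 : 2 * ω ^ 2 ≤ Real.exp (2 * ω + 2 * ω) := by
    have := Real.add_one_le_exp (2 * ω)
    rw [Real.exp_add]
    nlinarith
  have h4 : (‖y x'‖ + ‖dy x'‖) ^ 2 ≤
      ((‖y x‖ + ‖dy x‖) * Real.exp (((b - a) + Q + 2) * ω)) ^ 2 := by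
    calc _ ≤ 2 * ((ω * (‖y x‖ + ‖dy x‖)) ^ 2 * Real.exp (2 * ω * (b - a) + Q)) := by
          refine h1.trans (mul_le_mul_of_nonneg_left (main.trans ?_) (by norm_num))
          gcongr
      _ = (‖y x‖ + ‖dy x‖) ^ 2 * ((2 * ω ^ 2) * Real.exp (2 * ω * (b - a) + Q)) := by ring
      _ ≤ (‖y x‖ + ‖dy x‖) ^ 2 *
          (Real.exp (2 * ω + 2 * ω) * Real.exp (2 * ω * (b - a) + 2 * (Q * ω))) := by
          gcongr; nlinarith
      _ = _ := by
          rw [mul_pow, ← Real.exp_add, ← Real.exp_nat_mul]; congr 2; push_cast; ring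
  exact le_of_sq_le_sq h4 (by positivity)

theorem eqOn_of_eq (hab : a ≤ b) (hq : IntervalIntegrable q volume a b)
    (hy : IsSolutionOn q lam a b y dy) (hz : IsSolutionOn q lam a b z dz) {x : ℝ}
    (hx : x ∈ Icc a b) (h : y x = z x) (h' : dy x = dz x) :
    EqOn y z (Icc a b) ∧ EqOn dy dz (Icc a b) := by
  obtain ⟨C, -, hC⟩ := exists_norm_le hab hq
  have key : ∀ t ∈ Icc a b, ‖y t + (-1) * z t‖ + ‖dy t + (-1) * dz t‖ ≤ 0 := by
    intro t ht
    have := hC lam _ _ (hy.add (hz.const_mul (-1))) x hx t ht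
    simpa [h, h'] using this
  constructor <;> intro t ht <;> have h1 := key t ht
  · have : ‖y t + (-1) * z t‖ ≤ 0 := by linarith [norm_nonneg (dy t + (-1) * dz t)]
    have := norm_le_zero_iff.1 this
    linear_combination this
  · have : ‖dy t + (-1) * dz t‖ ≤ 0 := by linarith [norm_nonneg (y t + (-1) * z t)]
    have := norm_le_zero_iff.1 this
    linear_combination this

end IsSolutionOn

/-! ### Estimates for large spectral parameter by factorising the equation -/

namespace IsSolutionOn

open AbsolutelyContinuousOnInterval ComplexConjugate

variable {q r : ℝ → ℝ} {lam κ : ℂ} {a b : ℝ} {y dy z dz : ℝ → ℂ}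

/-- With `D = d/dx`, `D² + lam = (D - κ)(D + κ)`, so `p = y' + κ y` obeys a first-order equation in
which `q y` is a perturbation. Replacing `κ` by `-κ` gives the companion `n = y' - κ y`. -/
theorem ae_hasDerivAt_factor (hy : IsSolutionOn q lam a b y dy) (hκ : κ ^ 2 = -lam) :
    ∀ᵐ x, x ∈ Icc a b →
      HasDerivAt (fun x => dy x + κ * y x) (κ * (dy x + κ * y x) + q x * y x) x := by
  filter_upwards [hy.ae_hasDerivAt] with x h1 h2
  obtain ⟨h3, h4⟩ := h1 h2
  have e : κ * (dy x + κ * y x) + q x * y x = ((q x : ℂ) - lam) * y x + κ * dy x := by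
    linear_combination y x * hκ
  rw [e]
  exact h4.fun_add (h3.const_mul κ)

theorem absCont_factor (hab : a ≤ b) (hy : IsSolutionOn q lam a b y dy) (κ : ℂ) :
    AbsolutelyContinuousOnInterval (fun x => dy x + κ * y x) a b :=
  hy.absCont.add ((hy.absCont_self hab).const_smul κ)

theorem inner_mul_self (κ w : ℂ) : inner ℝ w (κ * w) = κ.re * ‖w‖ ^ 2 := by
  rw [← Complex.normSq_eq_norm_sq, Complex.normSq_apply, Complex.inner]
  simp only [Complex.mul_re, Complex.mul_im, Complex.conj_re, Complex.conj_im]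
  ring

theorem abs_inner_ofReal_mul_le (t : ℝ) (w v : ℂ) : |inner ℝ w ((t : ℂ) * v)| ≤ |t| * (‖w‖ * ‖v‖) := by
  refine (abs_real_inner_le_norm _ _).trans (le_of_eq ?_)
  rw [norm_mul, Complex.norm_real, Real.norm_eq_abs]; ring

theorem integral_le_of_subinterval {g : ℝ → ℝ} {x : ℝ} (hx : x ∈ Icc a b) (hg0 : ∀ t, 0 ≤ g t)
    (hg : IntervalIntegrable g volume a b) : ∫ t in x..b, g t ≤ ∫ t in a..b, g t :=
  intervalIntegral.integral_mono_interval hx.1 hx.2 le_rfl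
    (Filter.Eventually.of_forall hg0) hg

/-- From `2 κ y = p - n` one has `2 k |y| ≤ |p| + |n|`, so the potential contributes only `2 |q| /
k` to the rate of change of `|p|² + |n|²`. No sign condition is needed here, but both factors are.
-/
theorem factor_sq_add_le (hab : a ≤ b) (hq : IntervalIntegrable q volume a b)
    (hy : IsSolutionOn q lam a b y dy) (hκ : κ ^ 2 = -lam) (hk : 0 < κ.re) {x : ℝ}
    (hx : x ∈ Icc a b) :
    ‖dy x + κ * y x‖ ^ 2 + ‖dy x - κ * y x‖ ^ 2 ≤
      (‖dy b + κ * y b‖ ^ 2 + ‖dy b - κ * y b‖ ^ 2) *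
        Real.exp (2 * (κ.re * (b - x)) + 2 * ((∫ t in a..b, |q t|) / κ.re)) := by
  set k := κ.re with hkdef
  have hkn : k ≤ ‖κ‖ := (le_abs_self _).trans (Complex.abs_re_le_norm κ)
  have hκ' : (-κ) ^ 2 = -lam := by rw [neg_sq, hκ]
  set p := fun x => dy x + κ * y x with hp
  set n := fun x => dy x + -κ * y x with hn
  set E : ℝ → ℝ := fun x => ‖p x‖ ^ 2 + ‖n x‖ ^ 2 with hE
  have hEac : AbsolutelyContinuousOnInterval E a b :=
    (norm_sq_absCont (hy.absCont_factor hab κ)).add (norm_sq_absCont (hy.absCont_factor hab (-κ)))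
  set g : ℝ → ℝ := fun x => 2 * k + 2 / k * |q x| with hg
  have hder : ∀ᵐ x, x ∈ Icc a b → ∃ e ≥ -g x * E x, HasDerivAt E e x := by
    filter_upwards [hy.ae_hasDerivAt_factor hκ, hy.ae_hasDerivAt_factor hκ'] with x h1 h2 h3
    have h4 := (h1 h3).norm_sq
    have h5 := (h2 h3).norm_sq
    refine ⟨_, ?_, h4.add h5⟩
    rw [inner_add_right, inner_add_right, inner_mul_self, inner_mul_self]
    have i1 := neg_le_of_abs_le (abs_inner_ofReal_mul_le (q x) (p x) (y x))
    have i2 := neg_le_of_abs_le (abs_inner_ofReal_mul_le (q x) (n x) (y x))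
    have i3 : 2 * k * ‖y x‖ ≤ ‖p x‖ + ‖n x‖ := by
      have : 2 * κ * y x = p x - n x := by simp only [hp, hn]; ring
      have h6 : ‖2 * κ * y x‖ ≤ ‖p x‖ + ‖n x‖ := by rw [this]; exact norm_sub_le _ _
      rw [norm_mul, norm_mul, Complex.norm_two] at h6
      refine le_trans ?_ h6
      gcongr
    have i4 : ‖y x‖ * (‖p x‖ + ‖n x‖) ≤ E x / k := by
      rw [le_div_iff₀ hk]
      have := norm_add_norm_sq_le (A := ‖p x‖) (B := ‖n x‖)
      have : 0 ≤ ‖p x‖ + ‖n x‖ := by positivity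
      simp only [hE]
      nlinarith
    have i5 : |q x| * (‖y x‖ * (‖p x‖ + ‖n x‖)) ≤ |q x| * (E x / k) := by gcongr
    have i6 : g x * E x = 2 * k * E x + 2 * (|q x| * (E x / k)) := by
      simp only [hg]; field_simp
    have i7 : 0 ≤ k * ‖p x‖ ^ 2 := by positivity
    have i8 : -g x * E x = -(2 * k * E x + 2 * (|q x| * (E x / k))) := by rw [neg_mul, i6]
    rw [i8, Complex.neg_re]
    simp only [hE] at i5 ⊢
    simp only [hp, hn] at i1 i2 i5 i7 ⊢
    rw [← hkdef]
    nlinarith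
  have hs : uIcc x b ⊆ uIcc a b := by
    rw [uIcc_of_le hx.2, uIcc_of_le hab]; exact Icc_subset_Icc hx.1 le_rfl
  have hgi : IntervalIntegrable g volume a b := intervalIntegrable_const.add (hq.abs.const_mul _)
  have key := (hEac.mono hs).le_gronwall (g := fun x => -g x) hx.2 (hgi.mono_set hs).neg (by
    filter_upwards [hder] with t h1 h2
    exact h1 ⟨hx.1.trans h2.1, h2.2⟩)
  rw [intervalIntegral.integral_neg, Real.exp_neg, ← div_eq_mul_inv,
    div_le_iff₀ (Real.exp_pos _)] at key
  have hgI : ∫ t in x..b, g t ≤ 2 * (k * (b - x)) + 2 * ((∫ t in a..b, |q t|) / k) := by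
    rw [intervalIntegral.integral_add intervalIntegrable_const
      ((hq.abs.const_mul _).mono_set hs), intervalIntegral.integral_const,
      intervalIntegral.integral_const_mul, smul_eq_mul]
    have := integral_le_of_subinterval hx (fun t => abs_nonneg (q t)) hq.abs
    have h2 : 2 / k * ∫ t in x..b, |q t| ≤ 2 / k * ∫ t in a..b, |q t| := by gcongr
    have h3 : 2 / k * ∫ t in a..b, |q t| = 2 * ((∫ t in a..b, |q t|) / k) := by ring
    linarith
  have fin : E x ≤ E b * Real.exp (2 * (k * (b - x)) + 2 * ((∫ t in a..b, |q t|) / k)) := by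
    refine key.trans ?_
    have : 0 ≤ E b := by positivity
    gcongr
  simpa only [hE, hp, hn, neg_mul, ← sub_eq_add_neg] using fin

/-- By Lagrange's identity the left-hand side does not increase from left to right: a solution of
Weyl type at `a` remains so on `[a, b]`. -/
theorem im_mul_im_nonpos (hy : IsSolutionOn q lam a b y dy)
    (h : lam.im * (conj (y a) * dy a).im ≤ 0) {x : ℝ} (hx : x ∈ Icc a b) :
    lam.im * (conj (y x) * dy x).im ≤ 0 := by
  have h1 := (hy.mono le_rfl hx.1 hx.2).im_conj_mul_deriv_sub hx.1
  have h2 : 0 ≤ ∫ t in a..x, ‖y t‖ ^ 2 :=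
    intervalIntegral.integral_nonneg hx.1 fun _ _ => by positivity
  have h3 : (conj (y x) * dy x).im = (conj (y a) * dy a).im - lam.im * ∫ t in a..x, ‖y t‖ ^ 2 := by
    linarith
  rw [h3]
  nlinarith [mul_nonneg (mul_self_nonneg lam.im) h2]

/-- Since `Im lam = -2 Re κ Im κ`, the sign condition says `Im κ · Im (ū v) ≥ 0`. Hence the two
terms of `Im κ · Im (ū (v + κ u))` do not cancel, and it is at least `(Im κ)² |u|²`. This controls a
Weyl-type solution by its growing factor alone. -/
theorem abs_im_mul_norm_le {u v : ℂ} (hκ : κ ^ 2 = -lam) (hk : 0 < κ.re)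
    (h : lam.im * (conj u * v).im ≤ 0) : |κ.im| * ‖u‖ ≤ ‖v + κ * u‖ := by
  have hl : lam.im = -(2 * κ.re * κ.im) := by
    have := congrArg Complex.im hκ
    rw [Complex.neg_im, sq, Complex.mul_im] at this
    linarith
  have h1 : 0 ≤ κ.im * (conj u * v).im := by
    rw [hl] at h
    by_contra hc
    push Not at hc
    nlinarith
  have h2 : (conj u * (v + κ * u)).im = (conj u * v).im + κ.im * ‖u‖ ^ 2 := by
    rw [← Complex.normSq_eq_norm_sq, Complex.normSq_apply]
    simp only [Complex.mul_re, Complex.mul_im, Complex.conj_re, Complex.conj_im, Complex.add_re,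
      Complex.add_im]
    ring
  have h3 : |κ.im| ^ 2 * ‖u‖ ^ 2 ≤ |κ.im| * (‖u‖ * ‖v + κ * u‖) := by
    calc |κ.im| ^ 2 * ‖u‖ ^ 2 ≤ κ.im * (conj u * (v + κ * u)).im := by
          rw [h2, sq_abs]; nlinarith
      _ ≤ |κ.im| * |(conj u * (v + κ * u)).im| := by
          rw [← abs_mul]; exact le_abs_self _
      _ ≤ |κ.im| * ‖conj u * (v + κ * u)‖ := by gcongr; exact Complex.abs_im_le_norm _
      _ = _ := by rw [norm_mul, RCLike.norm_conj]
  rcases eq_or_lt_of_le (show 0 ≤ |κ.im| * ‖u‖ by positivity) with h0 | h0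
  · rw [← h0]; positivity
  · refine le_of_mul_le_mul_left ?_ h0
    calc _ = |κ.im| ^ 2 * ‖u‖ ^ 2 := by ring
      _ ≤ _ := h3
      _ = _ := by ring

/-- Because `k |y| ≤ |p|`, the equation for `p` closes without `n`: `(|p|²)' ≥ (2 k - 2 |q| / k)
|p|²`. So `p` grows at the full exponential rate towards `b`. -/
theorem factor_le (hab : a ≤ b) (hq : IntervalIntegrable q volume a b)
    (hy : IsSolutionOn q lam a b y dy) (hκ : κ ^ 2 = -lam) (hk : 0 < κ.re) (hki : |κ.im| = κ.re)
    (h : lam.im * (conj (y a) * dy a).im ≤ 0) {x : ℝ} (hx : x ∈ Icc a b) :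
    ‖dy x + κ * y x‖ ≤
      ‖dy b + κ * y b‖ * Real.exp (-(κ.re * (b - x)) + (∫ t in a..b, |q t|) / κ.re) := by
  set k := κ.re with hkdef
  set p := fun x => dy x + κ * y x with hp
  set E : ℝ → ℝ := fun x => ‖p x‖ ^ 2 with hE
  have hEac : AbsolutelyContinuousOnInterval E a b := norm_sq_absCont (hy.absCont_factor hab κ)
  set g : ℝ → ℝ := fun x => 2 * k - 2 / k * |q x| with hg
  have hder : ∀ᵐ x, x ∈ Icc a b → ∃ e ≥ g x * E x, HasDerivAt E e x := by
    filter_upwards [hy.ae_hasDerivAt_factor hκ] with x h1 h3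
    refine ⟨_, ?_, (h1 h3).norm_sq⟩
    rw [inner_add_right, inner_mul_self]
    have i1 := neg_le_of_abs_le (abs_inner_ofReal_mul_le (q x) (p x) (y x))
    have i3 : k * ‖y x‖ ≤ ‖p x‖ := hki ▸ abs_im_mul_norm_le hκ hk (hy.im_mul_im_nonpos h h3)
    have i4 : ‖p x‖ * ‖y x‖ ≤ E x / k := by
      rw [le_div_iff₀ hk]
      simp only [hE]
      nlinarith [norm_nonneg (p x)]
    have i5 : |q x| * (‖p x‖ * ‖y x‖) ≤ |q x| * (E x / k) := by gcongr
    have i6 : g x * E x = 2 * k * E x - 2 * (|q x| * (E x / k)) := by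
      simp only [hg]; field_simp
    rw [i6]
    simp only [hE] at i5 ⊢
    simp only [hp] at i1 i5 ⊢
    rw [← hkdef]
    linarith
  have hs : uIcc x b ⊆ uIcc a b := by
    rw [uIcc_of_le hx.2, uIcc_of_le hab]; exact Icc_subset_Icc hx.1 le_rfl
  have hgi : IntervalIntegrable g volume a b := intervalIntegrable_const.sub (hq.abs.const_mul _)
  have key := (hEac.mono hs).le_gronwall (g := g) hx.2 (hgi.mono_set hs) (by
    filter_upwards [hder] with t h1 h2
    exact h1 ⟨hx.1.trans h2.1, h2.2⟩)
  have hgI : 2 * (k * (b - x)) - 2 * ((∫ t in a..b, |q t|) / k) ≤ ∫ t in x..b, g t := by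
    rw [intervalIntegral.integral_sub intervalIntegrable_const
      ((hq.abs.const_mul _).mono_set hs), intervalIntegral.integral_const,
      intervalIntegral.integral_const_mul, smul_eq_mul]
    have := integral_le_of_subinterval hx (fun t => abs_nonneg (q t)) hq.abs
    have h2 : 2 / k * ∫ t in x..b, |q t| ≤ 2 / k * ∫ t in a..b, |q t| := by gcongr
    have h3 : 2 / k * ∫ t in a..b, |q t| = 2 * ((∫ t in a..b, |q t|) / k) := by ring
    linarith
  have hE0 : 0 ≤ E x := by positivity
  have h1 : E x * Real.exp (2 * (k * (b - x)) - 2 * ((∫ t in a..b, |q t|) / k)) ≤ E b :=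
    le_trans (by gcongr) key
  rw [← le_div_iff₀ (Real.exp_pos _), div_eq_mul_inv, ← Real.exp_neg] at h1
  refine le_of_sq_le_sq ?_ (by positivity)
  rw [mul_pow, ← Real.exp_nat_mul]
  refine h1.trans (le_of_eq ?_)
  simp only [hE, hp]
  congr 2
  push_cast; ring

/-- Integrate `(exp (κ x) n)' = exp (κ x) q y`. The value of `n` at `a` reaches `b` damped by `exp
(-2 k (b - a))` relative to `p b`, and the integral is `O(1/k)` relative to `p b` by `factor_le`.
Thus `n b` is negligible against `p b`, that is, `y'` behaves like `κ y` at `b`. -/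
theorem factor_sub_le (hab : a ≤ b) (hq : IntervalIntegrable q volume a b)
    (hy : IsSolutionOn q lam a b y dy) (hκ : κ ^ 2 = -lam) (hk : 0 < κ.re) (hki : |κ.im| = κ.re)
    (h : lam.im * (conj (y a) * dy a).im ≤ 0) :
    ‖dy b - κ * y b‖ ≤ ‖dy b + κ * y b‖ * (Real.exp ((∫ t in a..b, |q t|) / κ.re) *
      (5 * Real.exp (-(2 * (κ.re * (b - a)))) + (∫ t in a..b, |q t|) / κ.re)) := by
  set k := κ.re with hkdef
  set Q := ∫ t in a..b, |q t| with hQ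
  set P := ‖dy b + κ * y b‖ with hP
  have hκ' : (-κ) ^ 2 = -lam := by rw [neg_sq, hκ]
  have ha : a ∈ Icc a b := left_mem_Icc.2 hab
  have hyp : ∀ x ∈ Icc a b, k * ‖y x‖ ≤ ‖dy x + κ * y x‖ := fun x hx =>
    hki ▸ abs_im_mul_norm_le hκ hk (hy.im_mul_im_nonpos h hx)
  have hexp : ∀ x : ℝ, ‖Complex.exp (κ * x)‖ = Real.exp (k * x) := fun x => by
    rw [Complex.norm_exp]; simp [hkdef]
  have hcd : ContDiff ℝ 1 (fun x : ℝ => Complex.exp (κ * x)) := by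
    have : ContDiff ℝ 1 (fun x : ℝ => (x : ℂ)) := Complex.ofRealCLM.contDiff
    fun_prop
  have hexpd : ∀ x : ℝ, HasDerivAt (fun x : ℝ => Complex.exp (κ * x)) (Complex.exp (κ * x) * κ) x :=
    fun x => by
      have := ((hasDerivAt_id (x : ℂ)).const_mul κ).cexp.comp_ofReal
      simpa using this
  have hac : AbsolutelyContinuousOnInterval
      (fun x : ℝ => Complex.exp (κ * x) * (dy x + -κ * y x)) a b :=
    (of_contDiff hcd).cmul (hy.absCont_factor hab (-κ))
  have hqy : IntervalIntegrable (fun x => (q x : ℂ) * (Complex.exp (κ * x) * y x)) volume a b := by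
    have : IntervalIntegrable (fun x => (q x : ℂ)) volume a b := ⟨hq.1.ofReal, hq.2.ofReal⟩
    refine this.mul_continuousOn ?_
    rw [uIcc_of_le hab]
    exact hcd.continuous.continuousOn.mul hy.continuousOn
  have hFTC := hac.integral_eq_sub_of_ae_hasDerivAt hqy (by
    rw [uIcc_of_le hab]
    filter_upwards [hy.ae_hasDerivAt_factor hκ'] with x h1 h2
    have h3 := (hexpd x).fun_mul (h1 h2)
    have e : Complex.exp (κ * x) * κ * (dy x + -κ * y x) +
        Complex.exp (κ * x) * (-κ * (dy x + -κ * y x) + q x * y x) =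
        (q x : ℂ) * (Complex.exp (κ * x) * y x) := by ring
    rwa [e] at h3)
  have hint : ‖∫ x in a..b, (q x : ℂ) * (Complex.exp (κ * x) * y x)‖ ≤
      ∫ x in a..b, |q x| * (Real.exp (k * b) * (P * Real.exp (Q / k)) / k) := by
    refine intervalIntegral.norm_integral_le_of_norm_le hab
      (Filter.Eventually.of_forall fun x hx => ?_) (hq.abs.mul_const _)
    have hx' := Ioc_subset_Icc_self hx
    rw [norm_mul, norm_mul, Complex.norm_real, Real.norm_eq_abs, hexp]
    gcongr
    rw [le_div_iff₀ hk]
    have h1 := (hyp x hx').trans (hy.factor_le hab hq hκ hk hki h hx')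
    calc Real.exp (k * x) * ‖y x‖ * k = Real.exp (k * x) * (k * ‖y x‖) := by ring
      _ ≤ Real.exp (k * x) * (P * Real.exp (-(k * (b - x)) + Q / k)) := by gcongr
      _ = (Real.exp (k * x) * Real.exp (-(k * (b - x)))) * (P * Real.exp (Q / k)) := by
          rw [Real.exp_add]; ring
      _ ≤ Real.exp (k * b) * (P * Real.exp (Q / k)) := by
          rw [← Real.exp_add]
          gcongr
          nlinarith [hx.2]
  rw [intervalIntegral.integral_mul_const, hFTC] at hint
  -- The factor `5` is `1 + 4`: `|n| ≤ |p| + 2 |κ| |y|` with `|κ| ≤ 2 k` and `k |y| ≤ |p|`.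
  have hna : ‖dy a + -κ * y a‖ ≤ 5 * (P * Real.exp (-(k * (b - a)) + Q / k)) := by
    have h1 := hy.factor_le hab hq hκ hk hki h ha
    have h2 := hyp a ha
    have h3 : ‖κ‖ ≤ 2 * k := by
      refine (Complex.norm_le_abs_re_add_abs_im κ).trans ?_
      rw [hki, abs_of_pos (hkdef ▸ hk)]; linarith
    have h4 : ‖dy a + -κ * y a‖ ≤ ‖dy a + κ * y a‖ + 2 * (‖κ‖ * ‖y a‖) := by
      have : dy a + -κ * y a = (dy a + κ * y a) - 2 * (κ * y a) := by ring
      rw [this]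
      refine (norm_sub_le _ _).trans ?_
      rw [norm_mul, norm_mul, Complex.norm_two]
    have h5 : ‖κ‖ * ‖y a‖ ≤ 2 * k * ‖y a‖ := by gcongr
    linarith
  have h1 : ‖Complex.exp (κ * b) * (dy b + -κ * y b)‖ ≤
      ‖Complex.exp (κ * a) * (dy a + -κ * y a)‖ +
        Q * (Real.exp (k * b) * (P * Real.exp (Q / k)) / k) := by
    have := norm_sub_norm_le (Complex.exp (κ * b) * (dy b + -κ * y b))
      (Complex.exp (κ * a) * (dy a + -κ * y a))
    linarith
  rw [norm_mul, norm_mul, hexp, hexp] at h1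
  have h2 : Real.exp (k * a) * ‖dy a + -κ * y a‖ ≤
      Real.exp (k * a) * (5 * (P * Real.exp (-(k * (b - a)) + Q / k))) := by gcongr
  have h3 : Real.exp (k * a) * (5 * (P * Real.exp (-(k * (b - a)) + Q / k))) =
      Real.exp (k * b) * (P * (Real.exp (Q / k) * (5 * Real.exp (-(2 * (k * (b - a))))))) := by
    have : Real.exp (k * a) = Real.exp (k * b) * Real.exp (-(k * (b - a))) := by
      rw [← Real.exp_add]; congr 1; ring
    have h' : Real.exp (-(2 * (k * (b - a)))) =
        Real.exp (-(k * (b - a))) * Real.exp (-(k * (b - a))) := by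
      rw [← Real.exp_add]; congr 1; ring
    rw [this, h', Real.exp_add]; ring
  have h4 : dy b - κ * y b = dy b + -κ * y b := by ring
  rw [h4]
  refine le_of_mul_le_mul_left ?_ (Real.exp_pos (k * b))
  calc _ ≤ _ := h1
    _ ≤ Real.exp (k * b) * (P * (Real.exp (Q / k) * (5 * Real.exp (-(2 * (k * (b - a))))))) +
        Q * (Real.exp (k * b) * (P * Real.exp (Q / k)) / k) := by linarith
    _ = _ := by ring

/-- Take a companion `ψ` with `y ψ' - y' ψ = 1`. For `η = (x - a)(b - x)`, which vanishes at both
ends, integrating `(η y ψ)'` gives `∫ η = ∫ y (2 η ψ' + η' ψ)`. As `ψ` and `ψ'` are at most of size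
`exp (C ω)`, `y` cannot be smaller than the inverse of such a bound in mean square. -/
theorem exists_le_integral_norm_sq (hab : a < b) (hq : IntervalIntegrable q volume a b) :
    ∃ c > 0, ∃ C > 0, ∀ (lam : ℂ) (y dy : ℝ → ℂ) (v₀ v₁ : ℂ), IsSolutionOn q lam a b y dy →
      y a * v₁ - dy a * v₀ = 1 → ‖v₀‖ + ‖v₁‖ ≤ 2 →
      c * Real.exp (-(C * (1 + √‖lam‖))) ≤ ∫ x in a..b, ‖y x‖ ^ 2 := by
  obtain ⟨C, hC, hle⟩ := exists_norm_le hab.le hq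
  set L := b - a with hL
  have hL0 : 0 < L := sub_pos.2 hab
  set D := 2 * (2 * L ^ 2 + L) with hD
  have hD0 : 0 < D := by positivity
  refine ⟨L ^ 5 / (36 * D ^ 2), by positivity, 2 * C, by positivity, ?_⟩
  intro lam y dy v₀ v₁ hy hW hv
  obtain ⟨ψ, dψ, hψ, -⟩ := exists_isSolutionOn_differentiable hab.le hq v₀ v₁
  obtain ⟨hψs, hψ0, hψ1⟩ := hψ lam
  set ω := 1 + √‖lam‖ with hω
  set B := D * Real.exp (C * ω) with hB
  have hB0 : 0 < B := by positivity
  set η : ℝ → ℝ := fun x => (x - a) * (b - x) with hη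
  set η' : ℝ → ℝ := fun x => (b - x) - (x - a) with hη'
  have hηd : ∀ x, HasDerivAt (fun x => (η x : ℂ)) (η' x : ℂ) x := fun x => by
    have : HasDerivAt η (η' x) x := by
      have := ((hasDerivAt_id x).sub_const a).fun_mul ((hasDerivAt_id x).const_sub b)
      exact this.congr_deriv (by simp only [hη', id]; ring)
    exact this.ofReal_comp
  have hηc : ContDiff ℝ 1 (fun x => (η x : ℂ)) := by
    have : ContDiff ℝ 1 (fun x : ℝ => (x : ℂ)) := Complex.ofRealCLM.contDiff
    simp only [hη, Complex.ofReal_mul, Complex.ofReal_sub]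
    fun_prop
  have hη'c : Continuous (fun x => (η' x : ℂ)) := by
    simp only [hη']; fun_prop
  set G : ℝ → ℂ := fun x => y x * (2 * η x * dψ lam x + η' x * ψ lam x) with hG
  have hGc : ContinuousOn G (Icc a b) :=
    hy.continuousOn.mul (((continuousOn_const.mul hηc.continuous.continuousOn).mul
      (hψs.continuousOn_deriv hab.le)).add (hη'c.continuousOn.mul hψs.continuousOn))
  have hGi : IntervalIntegrable G volume a b :=
    ContinuousOn.intervalIntegrable (by rwa [uIcc_of_le hab.le])
  have hηi : IntervalIntegrable (fun x => (η x : ℂ)) volume a b :=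
    hηc.continuous.intervalIntegrable _ _
  have hGη : ∫ x in a..b, (G x - η x) = 0 := by
    have hac : AbsolutelyContinuousOnInterval (fun x => (η x : ℂ) * (y x * ψ lam x)) a b :=
      (of_contDiff hηc).cmul ((hy.absCont_self hab.le).cmul (hψs.absCont_self hab.le))
    have := hac.integral_eq_sub_of_ae_hasDerivAt (hGi.sub hηi) (by
      rw [uIcc_of_le hab.le]
      filter_upwards [hy.ae_hasDerivAt, hψs.ae_hasDerivAt] with x h1 h2 h3
      have h4 := (hηd x).fun_mul ((h1 h3).1.fun_mul (h2 h3).1)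
      have h5 := hy.wronskian_eq hab.le hψs h3
      rw [hψ0, hψ1, hW] at h5
      have e : (η' x : ℂ) * (y x * ψ lam x) + η x * (dy x * ψ lam x + y x * dψ lam x) =
          G x - η x := by
        simp only [hG]; linear_combination -(η x : ℂ) * h5
      rwa [e] at h4)
    rw [this]
    simp [hη]
  rw [intervalIntegral.integral_sub hGi hηi, sub_eq_zero, intervalIntegral.integral_ofReal] at hGη
  have hηI : ∫ x in a..b, η x = L ^ 3 / 6 := by
    have : ∀ x, HasDerivAt (fun x => L * (x - a) ^ 2 / 2 - (x - a) ^ 3 / 3) (η x) x := by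
      intro x
      have h1 := ((hasDerivAt_id x).sub_const a)
      have h2 := (((h1.pow 2).const_mul L).div_const 2).sub ((h1.pow 3).div_const 3)
      exact h2.congr_deriv (by simp only [hη, hL, id]; ring)
    rw [intervalIntegral.integral_eq_sub_of_hasDerivAt (fun x _ => this x)
      ((by simp only [hη]; fun_prop : Continuous η).intervalIntegrable _ _)]
    rw [← hL]; ring
  have hbnd : ∀ x ∈ Icc a b, ‖2 * (η x : ℂ) * dψ lam x + η' x * ψ lam x‖ ≤ B := by
    intro x hx
    have h1 : |η x| ≤ L ^ 2 := by
      rw [abs_of_nonneg (mul_nonneg (sub_nonneg.2 hx.1) (sub_nonneg.2 hx.2))]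
      simp only [hL, sq]
      have := hx.1; have := hx.2
      gcongr
    have h2 : |η' x| ≤ L := by
      rw [abs_le]; simp only [hη', hL]; constructor <;> linarith [hx.1, hx.2]
    have h3 := hle lam _ _ hψs a (left_mem_Icc.2 hab.le) x hx
    rw [hψ0, hψ1] at h3
    have h4 : ‖ψ lam x‖ + ‖dψ lam x‖ ≤ 2 * Real.exp (C * ω) :=
      h3.trans (by gcongr)
    calc _ ≤ 2 * |η x| * ‖dψ lam x‖ + |η' x| * ‖ψ lam x‖ := by
          refine (norm_add_le _ _).trans (le_of_eq ?_)
          simp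
      _ ≤ 2 * L ^ 2 * (2 * Real.exp (C * ω)) + L * (2 * Real.exp (C * ω)) := by
          gcongr
          · linarith [norm_nonneg (ψ lam x)]
          · linarith [norm_nonneg (dψ lam x)]
      _ = B := by simp only [hB, hD]; ring
  have hyi : IntervalIntegrable (fun x => ‖y x‖ ^ 2) volume a b :=
    ContinuousOn.intervalIntegrable (by
      rw [uIcc_of_le hab.le]; exact (hy.continuousOn.norm.pow 2))
  set I := ∫ x in a..b, ‖y x‖ ^ 2 with hI
  -- Parameter of Young's inequality, chosen so that the constant term `L * (B * t / 2)` is exactly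
  -- half of `∫ η = L ^ 3 / 6`.
  set t := L ^ 2 / (6 * B) with ht
  have ht0 : 0 < t := by positivity
  have h1 : L ^ 3 / 6 ≤ L * (B * t / 2) + B / (2 * t) * I := by
    calc L ^ 3 / 6 = ‖∫ x in a..b, G x‖ := by
          rw [hGη, hηI, Complex.norm_real, Real.norm_eq_abs, abs_of_pos (by positivity)]
      _ ≤ ∫ x in a..b, (B * t / 2 + B / (2 * t) * ‖y x‖ ^ 2) := by
          refine intervalIntegral.norm_integral_le_of_norm_le hab.le
            (Filter.Eventually.of_forall fun x hx => ?_)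
            (intervalIntegrable_const.add (hyi.const_mul _))
          have h2 := hbnd x (Ioc_subset_Icc_self hx)
          simp only [hG, norm_mul]
          calc _ ≤ ‖y x‖ * B := by gcongr
            _ ≤ _ := by
              have : B * t / 2 + B / (2 * t) * ‖y x‖ ^ 2 - ‖y x‖ * B =
                B / (2 * t) * (t - ‖y x‖) ^ 2 := by field_simp; ring
              have : 0 ≤ B / (2 * t) * (t - ‖y x‖) ^ 2 := by positivity
              linarith
      _ = _ := by
          rw [intervalIntegral.integral_add intervalIntegrable_const (hyi.const_mul _),
            intervalIntegral.integral_const, intervalIntegral.integral_const_mul, smul_eq_mul]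
  have h2 : L * (B * t / 2) = L ^ 3 / 12 := by rw [ht]; field_simp; norm_num
  have h3 : L ^ 3 / 12 ≤ B / (2 * t) * I := by linarith
  have h4 : B / (2 * t) = 3 * B ^ 2 / L ^ 2 := by rw [ht]; field_simp; norm_num
  rw [h4, div_mul_eq_mul_div, le_div_iff₀ (by positivity)] at h3
  have h5 : Real.exp (-(2 * C * ω)) = (Real.exp (C * ω) ^ 2)⁻¹ := by
    rw [← Real.exp_nat_mul, ← Real.exp_neg]; congr 1; push_cast; ring
  rw [h5, ← div_eq_mul_inv, div_div, div_le_iff₀ (by positivity)]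
  have h6 : 36 * D ^ 2 * Real.exp (C * ω) ^ 2 = 36 * B ^ 2 := by rw [hB]; ring
  rw [h6]
  nlinarith

end IsSolutionOn

/-! ### Entire functions of order at most one half -/

section EntireFunctions

open Filter Topology Metric

/-- A zero-free entire function of order at most `1 / 2` is constant. -/
theorem entire_eq_of_ne_zero_of_norm_le {h : ℂ → ℂ} (hd : Differentiable ℂ h)
    (h0 : ∀ z, h z ≠ 0) {A B : ℝ} (hA : 0 < A) (hB : 0 ≤ B)
    (hb : ∀ z, ‖h z‖ ≤ A * Real.exp (B * √‖z‖)) (z : ℂ) : h z = h 0 := by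
  set L := Complex.log (h 0) with hL
  -- On the disc of radius `R` there is a logarithm of `h` whose real part is `O(√R)`.
  -- Borel–Carathéodory then bounds its increment from `0` to `z` by `O(√R / R)`, which tends to
  -- zero.
  have key : ∀ R : ℝ, 2 * ‖z‖ + 1 ≤ R → ∃ u : ℂ, h z = h 0 * Complex.exp u ∧
      ‖u‖ ≤ 4 * (|Real.log A| + ‖L‖ + 1 + B * √R) * ‖z‖ / R := by
    intro R hR
    have hR0 : 0 < R := by linarith [norm_nonneg z]
    have hlog : DifferentiableOn ℂ (fun z => deriv h z / h z) (ball 0 R) :=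
      ((hd.deriv).div hd h0).differentiableOn
    obtain ⟨g, hg0, hg⟩ := (hlog.isExactOn_ball).with_val_at 0 L
    have hgd : DifferentiableOn ℂ g (ball 0 R) := fun w hw =>
      (hg w hw).differentiableAt.differentiableWithinAt
    obtain ⟨c, hc⟩ := isOpen_ball.exists_is_const_of_deriv_eq_zero
      (f := fun w => h w * Complex.exp (-g w)) (convex_ball 0 R).isPreconnected
      (hd.differentiableOn.mul hgd.neg.cexp) (fun w hw => by
        have h1 := (hd w).hasDerivAt.mul (hg w hw).neg.cexp
        have h2 := h0 w
        change deriv (h * fun x => Complex.exp ((-g) x)) w = 0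
        rw [h1.deriv]
        simp only [Pi.neg_apply]
        field_simp
        ring)
    have hball0 : (0 : ℂ) ∈ ball (0 : ℂ) R := mem_ball_self hR0
    have hc1 : c = 1 := by
      rw [← hc 0 hball0, hg0, Complex.exp_neg, hL, Complex.exp_log (h0 0),
        mul_inv_cancel₀ (h0 0)]
    have hexp : ∀ w ∈ ball (0 : ℂ) R, h w = Complex.exp (g w) := by
      intro w hw
      have := hc w hw
      rw [hc1] at this
      rw [Complex.exp_neg, ← div_eq_mul_inv, div_eq_one_iff_eq (Complex.exp_ne_zero _)] at this
      exact this
    have hz : z ∈ ball (0 : ℂ) R := by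
      rw [mem_ball_zero_iff]; linarith [norm_nonneg z]
    refine ⟨g z - L, ?_, ?_⟩
    · rw [hexp z hz, hexp 0 hball0, hg0, ← Complex.exp_add]; congr 1; ring
    · set M := |Real.log A| + ‖L‖ + 1 + B * √R with hM
      have hM0 : 0 < M := by positivity
      have h1 := Complex.borelCaratheodory_zero (f := fun w => g w - L) hM0 (hgd.sub_const L)
        (fun w hw => by
          simp only [Set.mem_ofPred_eq, Complex.sub_re]
          have h2 := hb w
          rw [hexp w hw, Complex.norm_exp, ← Real.exp_log hA, ← Real.exp_add,
            Real.exp_le_exp] at h2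
          have h3 : √‖w‖ ≤ √R := Real.sqrt_le_sqrt (mem_ball_zero_iff.1 hw).le
          have h4 : B * √‖w‖ ≤ B * √R := by gcongr
          have h5 := le_abs_self (Real.log A)
          have h6 := neg_le_of_abs_le (Complex.abs_re_le_norm L)
          linarith) hR0 hz (by simp [hg0])
      refine h1.trans ?_
      rw [div_le_div_iff₀ (by linarith [norm_nonneg z]) hR0]
      have : R ≤ 2 * (R - ‖z‖) := by linarith
      calc 2 * M * ‖z‖ * R ≤ 2 * M * ‖z‖ * (2 * (R - ‖z‖)) := by gcongr
        _ = _ := by ring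
  have hlim : Tendsto (fun R : ℝ => 4 * (|Real.log A| + ‖L‖ + 1 + B * √R) * ‖z‖ / R) atTop
      (𝓝 0) := by
    have h1 : Tendsto (fun R : ℝ => R⁻¹) atTop (𝓝 0) := tendsto_inv_atTop_zero
    have h2 : Tendsto (fun R : ℝ => (√R)⁻¹) atTop (𝓝 0) :=
      tendsto_inv_atTop_zero.comp Real.tendsto_sqrt_atTop
    have h3 := (h1.const_mul (4 * (|Real.log A| + ‖L‖ + 1) * ‖z‖)).add
      (h2.const_mul (4 * B * ‖z‖))
    rw [mul_zero, mul_zero, add_zero] at h3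
    refine h3.congr' ?_
    filter_upwards [eventually_gt_atTop 0] with R hR
    have : √R * √R = R := Real.mul_self_sqrt hR.le
    have h4 : (√R)⁻¹ = √R / R := by
      rw [inv_eq_one_div, div_eq_div_iff (Real.sqrt_pos.2 hR).ne' hR.ne', this, one_mul]
    rw [h4]
    field_simp
  have hev : ∀ᶠ R : ℝ in atTop, ‖h z - h 0‖ ≤
      ‖h 0‖ * (2 * (4 * (|Real.log A| + ‖L‖ + 1 + B * √R) * ‖z‖ / R)) := by
    filter_upwards [eventually_ge_atTop (2 * ‖z‖ + 1), hlim.eventually_le_const (one_pos)] with R h1 h2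
    obtain ⟨u, hu, hu'⟩ := key R h1
    rw [hu, ← mul_sub_one, norm_mul]
    gcongr
    refine (Complex.norm_exp_sub_one_le (hu'.trans h2)).trans ?_
    gcongr
  have hlim2 := (hlim.const_mul 2).const_mul ‖h 0‖
  rw [mul_zero, mul_zero] at hlim2
  have := ge_of_tendsto hlim2 hev
  exact sub_eq_zero.1 (norm_le_zero_iff.1 this)

/-- An entire function of order at most `1 / 2` which tends to zero along both imaginary half-axes
vanishes. -/
theorem entire_eq_zero_of_tendsto_zero_imaginary {D : ℂ → ℂ} (hd : Differentiable ℂ D)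
    {K C : ℝ} (hb : ∀ z, ‖D z‖ ≤ K * Real.exp (C * (1 + √‖z‖)))
    (h1 : Tendsto (fun k : ℝ => D (2 * k ^ 2 * Complex.I)) atTop (𝓝 0))
    (h2 : Tendsto (fun k : ℝ => D (-(2 * k ^ 2 * Complex.I))) atTop (𝓝 0)) (z : ℂ) : D z = 0 := by
  have bdd : ∀ f : ℝ → ℂ, Continuous f → Tendsto f atTop (𝓝 0) → ∃ M, ∀ x, 0 ≤ x → ‖f x‖ ≤ M := by
    intro f hf hl
    obtain ⟨N, hN⟩ := eventually_atTop.1 (hl.norm.eventually_le_const (by simp : ‖(0 : ℂ)‖ < 1))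
    obtain ⟨M, hM⟩ := (isCompact_Icc (a := 0) (b := N)).exists_bound_of_continuousOn hf.continuousOn
    refine ⟨max M 1, fun x hx => ?_⟩
    rcases le_total x N with h | h
    · exact (hM x ⟨hx, h⟩).trans (le_max_left _ _)
    · exact (hN x h).trans (le_max_right _ _)
  obtain ⟨M₁, hM₁⟩ := bdd _ (hd.continuous.comp (by fun_prop)) h1
  obtain ⟨M₂, hM₂⟩ := bdd _ (hd.continuous.comp (by fun_prop)) h2
  set M := max M₁ M₂ with hM
  -- The substitution `z = 2 i w²` gives an even function of exponential type. Real `w` cover the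
  -- positive imaginary half-axis and imaginary `w` the negative one, so `f` is bounded on the sides
  -- of each quadrant, where Phragmén–Lindelöf admits growth of order one.
  set f : ℂ → ℂ := fun w => D (2 * w ^ 2 * Complex.I) with hf
  have hfd : Differentiable ℂ f := hd.comp (by fun_prop)
  have hfneg : ∀ w, f (-w) = f w := fun w => by simp only [hf, neg_sq]
  have hfI : ∀ x : ℝ, f (x * Complex.I) = D (-(2 * x ^ 2 * Complex.I)) := fun x => by
    simp only [hf, mul_pow, Complex.I_sq]; congr 1; ring
  have hre : ∀ x : ℝ, 0 ≤ x → ‖f x‖ ≤ M := fun x hx => (hM₁ x hx).trans (le_max_left _ _)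
  have him : ∀ x : ℝ, 0 ≤ x → ‖f (x * Complex.I)‖ ≤ M := fun x hx => by
    rw [hfI]; exact (hM₂ x hx).trans (le_max_right _ _)
  have hre' : ∀ x : ℝ, x ≤ 0 → ‖f x‖ ≤ M := fun x hx => by
    rw [← hfneg, ← Complex.ofReal_neg]; exact hre _ (neg_nonneg.2 hx)
  have hO : ∀ l : Filter ℂ, f =O[l] fun z => Real.exp (C * √2 * ‖z‖ ^ (1 : ℝ)) := by
    intro l
    refine Asymptotics.IsBigO.of_bound (K * Real.exp C) (Eventually.of_forall fun w => ?_)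
    refine (hb _).trans (le_of_eq ?_)
    have : √‖2 * w ^ 2 * Complex.I‖ = √2 * ‖w‖ := by
      rw [norm_mul, norm_mul, Complex.norm_I, mul_one, norm_pow, Complex.norm_two,
        Real.sqrt_mul (by norm_num), Real.sqrt_sq (norm_nonneg _)]
    rw [this, Real.norm_eq_abs, Real.abs_exp, Real.rpow_one, mul_assoc, ← Real.exp_add]
    congr 2; ring
  have hup : ∀ w : ℂ, 0 ≤ w.im → ‖f w‖ ≤ M := by
    intro w hw
    rcases le_total 0 w.re with h | h
    · exact PhragmenLindelof.quadrant_I hfd.diffContOnCl ⟨1, by norm_num, _, hO _⟩ hre him h hw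
    · exact PhragmenLindelof.quadrant_II hfd.diffContOnCl ⟨1, by norm_num, _, hO _⟩ hre' him h hw
  have hall : ∀ w : ℂ, ‖f w‖ ≤ M := by
    intro w
    rcases le_total 0 w.im with h | h
    · exact hup w h
    · rw [← hfneg]; exact hup _ (by simpa using h)
  have hDb : ∀ z, ‖D z‖ ≤ M := by
    intro z
    obtain ⟨w, hw⟩ := IsAlgClosed.exists_pow_nat_eq (z / (2 * Complex.I)) (n := 2) (by norm_num)
    have : 2 * w ^ 2 * Complex.I = z := by
      rw [hw]; field_simp
    rw [← this]; exact hall w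
  obtain ⟨c, hc⟩ := hd.exists_const_forall_eq_of_bounded
    (isBounded_iff_forall_norm_le.2 ⟨M, by rintro _ ⟨z, rfl⟩; exact hDb z⟩)
  have : Tendsto (fun _ : ℝ => c) atTop (𝓝 0) := h1.congr fun k => hc _
  rw [hc z]
  exact tendsto_nhds_unique tendsto_const_nhds this

/-- The lower bound puts every zero on the real axis. It is linear in `Im z`, so the difference
quotients along `z + i ε` stay away from zero. -/
theorem deriv_ne_zero_of_le_norm {F : ℂ → ℂ} (hF : Differentiable ℂ F) {c C : ℝ} (hc : 0 < c)
    (lower : ∀ z, c * |z.im| * Real.exp (-(C * (1 + √‖z‖))) ≤ ‖F z‖) {z : ℂ} (hz : F z = 0) :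
    deriv F z ≠ 0 := by
  have him : z.im = 0 := by
    have := lower z
    rw [hz, norm_zero] at this
    have h2 := Real.exp_pos (-(C * (1 + √‖z‖)))
    by_contra h
    have : 0 < c * |z.im| * Real.exp (-(C * (1 + √‖z‖))) := by positivity
    linarith
  have hcont : ContinuousAt (dslope F z) z := continuousAt_dslope_same.2 (hF z)
  have hpath : Tendsto (fun ε : ℝ => z + ε * Complex.I) (𝓝[>] 0) (𝓝 z) := by
    have : Continuous (fun ε : ℝ => z + ε * Complex.I) := by fun_prop
    simpa using (this.tendsto 0).mono_left nhdsWithin_le_nhds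
  have h1 := (hcont.tendsto.comp hpath).norm
  rw [dslope_same] at h1
  have h2 : Tendsto (fun ε : ℝ => c * Real.exp (-(C * (1 + √‖z + ε * Complex.I‖)))) (𝓝[>] 0)
      (𝓝 (c * Real.exp (-(C * (1 + √‖z‖))))) := by
    have hcz : Continuous fun w : ℂ => c * Real.exp (-(C * (1 + √‖w‖))) := by fun_prop
    exact (hcz.tendsto z).comp hpath
  have h3 := le_of_tendsto_of_tendsto h2 h1 (by
    filter_upwards [self_mem_nhdsWithin] with ε hε
    have hε : 0 < ε := hε
    have h4 := lower (z + ε * Complex.I)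
    have h5 := sub_smul_dslope F z (z + ε * Complex.I)
    rw [hz, sub_zero, add_sub_cancel_left, smul_eq_mul] at h5
    rw [← h5, norm_mul, norm_mul, Complex.norm_I, mul_one, Complex.norm_real] at h4
    simp only [Complex.add_im, Complex.mul_im, Complex.ofReal_re, Complex.I_im, Complex.ofReal_im,
      Complex.I_re, him, mul_one, mul_zero, zero_add, add_zero, Real.norm_eq_abs] at h4
    simp only [Function.comp]
    refine le_of_mul_le_mul_left (a := |ε|) ?_ (by positivity)
    linarith)
  intro h0
  rw [h0, norm_zero] at h3
  have : 0 < c * Real.exp (-(C * (1 + √‖z‖))) := by positivity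
  linarith

/-- Two entire functions of order at most `1 / 2`, not too small off the real axis and with
the same zeros, are proportional. -/
theorem exists_eq_const_mul_of_zeros {F G : ℂ → ℂ} (hF : Differentiable ℂ F)
    (hG : Differentiable ℂ G) {c C K : ℝ} (hc : 0 < c) (hC : 0 < C) (hK : 0 < K)
    (upper : ∀ z, ‖F z‖ ≤ K * Real.exp (C * (1 + √‖z‖)))
    (lowerF : ∀ z, c * |z.im| * Real.exp (-(C * (1 + √‖z‖))) ≤ ‖F z‖)
    (lowerG : ∀ z, c * |z.im| * Real.exp (-(C * (1 + √‖z‖))) ≤ ‖G z‖)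
    (zeros : ∀ z, F z = 0 ↔ G z = 0) : ∃ c₀ : ℂ, c₀ ≠ 0 ∧ ∀ z, F z = c₀ * G z := by
  classical
  -- The quotient `F / G` with its removable singularities filled in: the common zeros are simple,
  -- so the value there is the ratio of derivatives.
  set h : ℂ → ℂ := fun z => if G z = 0 then deriv F z / deriv G z else F z / G z with hh
  have hFG : ∀ z, F z = h z * G z := by
    intro z
    by_cases hz : G z = 0
    · rw [hz, mul_zero, (zeros z).2 hz]
    · simp [hh, hz]
  have hne : ∀ z, h z ≠ 0 := by
    intro z
    by_cases hz : G z = 0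
    · simp only [hh, hz, if_true]
      exact div_ne_zero (deriv_ne_zero_of_le_norm hF hc lowerF ((zeros z).2 hz))
        (deriv_ne_zero_of_le_norm hG hc lowerG hz)
    · simp only [hh, hz, if_false]
      exact div_ne_zero (fun h => hz ((zeros z).1 h)) hz
  have hd : Differentiable ℂ h := by
    intro z
    by_cases hz : G z = 0
    · have dF : DifferentiableAt ℂ (dslope F z) z :=
        ((Complex.differentiableOn_dslope univ_mem).2 hF.differentiableOn).differentiableAt univ_mem
      have dG : DifferentiableAt ℂ (dslope G z) z :=
        ((Complex.differentiableOn_dslope univ_mem).2 hG.differentiableOn).differentiableAt univ_mem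
      have hG' : dslope G z z ≠ 0 := by
        rw [dslope_same]; exact deriv_ne_zero_of_le_norm hG hc lowerG hz
      refine (dF.div dG hG').congr_of_eventuallyEq ?_
      filter_upwards [dG.continuousAt.eventually_ne hG'] with w hw
      by_cases hwz : w = z
      · subst hwz; simp [hh, hz]
      · have h1 := sub_smul_dslope F z w
        have h2 := sub_smul_dslope G z w
        rw [(zeros z).2 hz, sub_zero, smul_eq_mul] at h1
        rw [hz, sub_zero, smul_eq_mul] at h2
        have h3 : w - z ≠ 0 := sub_ne_zero.2 hwz
        have h4 : G w ≠ 0 := by rw [← h2]; exact mul_ne_zero h3 hw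
        simp only [hh, h4, if_false, Pi.div_apply]
        rw [← h1, ← h2, mul_div_mul_left _ _ h3]
    · refine ((hF z).div (hG z) hz).congr_of_eventuallyEq ?_
      filter_upwards [(hG z).continuousAt.eventually_ne hz] with w hw
      simp [hh, hw]
  -- This bound degenerates at the real axis; the maximum principle on unit discs removes the factor
  -- `|Im z|`.
  have hb1 : ∀ z, |z.im| * ‖h z‖ ≤ K / c * Real.exp (2 * C * (1 + √‖z‖)) := by
    intro z
    have h1 := upper z
    rw [hFG z, norm_mul] at h1
    have h2 : ‖h z‖ * (c * |z.im| * Real.exp (-(C * (1 + √‖z‖)))) ≤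
        K * Real.exp (C * (1 + √‖z‖)) := le_trans (by gcongr; exact lowerG z) h1
    have h3 : Real.exp (2 * C * (1 + √‖z‖)) =
        Real.exp (C * (1 + √‖z‖)) * Real.exp (C * (1 + √‖z‖)) := by
      rw [← Real.exp_add]; congr 1; ring
    rw [Real.exp_neg, ← div_eq_mul_inv, ← mul_div_assoc, div_le_iff₀ (Real.exp_pos _)] at h2
    rw [h3, div_mul_eq_mul_div, le_div_iff₀ hc]
    linarith
  have hb2 : ∀ z, ‖h z‖ ≤ (2 * (K / c) * Real.exp (4 * C)) * Real.exp (2 * C * √‖z‖) := by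
    intro z
    have hexp : Real.exp (4 * C) * Real.exp (2 * C * √‖z‖) =
        Real.exp (2 * C * (2 + √‖z‖)) := by rw [← Real.exp_add]; congr 1; ring
    rw [mul_assoc, hexp]
    rcases le_or_gt 1 |z.im| with him | him
    · calc ‖h z‖ ≤ |z.im| * ‖h z‖ := le_mul_of_one_le_left (norm_nonneg _) him
        _ ≤ _ := hb1 z
        _ ≤ _ := by
          have : 0 < K / c := by positivity
          gcongr <;> linarith
    · set x : ℂ := (z.re : ℂ) with hx
      have hmem : z ∈ closure (ball x 1) := by
        rw [closure_ball _ one_ne_zero, mem_closedBall, Complex.dist_eq]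
        have : z - x = z.im * Complex.I := by
          simp only [hx]; linear_combination -(Complex.re_add_im z)
        rw [this, norm_mul, Complex.norm_I, mul_one, Complex.norm_real]
        exact him.le
      -- With `x = Re z`, the multiplier `(w - x)² - 1` has modulus exactly `2 |Im w|` on the circle
      -- `|w - x| = 1`, matching the degeneracy of the bound, and modulus `1 + (Im z)² ≥ 1` at `z`.
      have hmax := Complex.norm_le_of_forall_mem_frontier_norm_le isBounded_ball
        (f := fun w => ((w - x) ^ 2 - 1) * h w) (C := 2 * (K / c) * Real.exp (2 * C * (2 + √‖z‖)))
        (by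
          have : Differentiable ℂ (fun w => ((w - x) ^ 2 - 1) * h w) := by fun_prop
          exact this.diffContOnCl) (fun w hw => by
          rw [frontier_ball _ one_ne_zero, mem_sphere, Complex.dist_eq] at hw
          have h1 : ‖(w - x) ^ 2 - 1‖ = 2 * |w.im| := by
            have h2 : (w - x) * (starRingEnd ℂ) (w - x) = 1 := by
              rw [Complex.mul_conj, Complex.normSq_eq_norm_sq, hw]; simp
            have h3 : (w - x) ^ 2 - 1 = (w - x) * (((2 * (w - x).im : ℝ) : ℂ) * Complex.I) := by
              rw [← Complex.sub_conj, ← h2]; ring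
            rw [h3, norm_mul, hw, norm_mul, Complex.norm_I, Complex.norm_real, Real.norm_eq_abs,
              abs_mul, abs_two]
            simp [hx]
          rw [norm_mul, h1]
          have h4 : √‖w‖ ≤ 1 + √‖z‖ := by
            have h5 : ‖w‖ ≤ 1 + ‖z‖ := by
              have : w = (w - x) + x := by ring
              rw [this]
              refine (norm_add_le _ _).trans ?_
              rw [hw, hx, Complex.norm_real]
              gcongr
              exact Complex.abs_re_le_norm z
            rw [Real.sqrt_le_left (by positivity)]
            nlinarith [Real.sq_sqrt (norm_nonneg z), Real.sqrt_nonneg ‖z‖]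
          have h6 := hb1 w
          have h7 : Real.exp (2 * C * (1 + √‖w‖)) ≤ Real.exp (2 * C * (2 + √‖z‖)) := by
            rw [Real.exp_le_exp]; nlinarith
          have h8 : K / c * Real.exp (2 * C * (1 + √‖w‖)) ≤
            K / c * Real.exp (2 * C * (2 + √‖z‖)) := by gcongr
          linarith) hmem
      refine le_trans ?_ hmax
      simp only [norm_mul]
      refine le_mul_of_one_le_left (norm_nonneg _) ?_
      have h1 : (z - x) ^ 2 - 1 = ((-(z.im ^ 2 + 1) : ℝ) : ℂ) := by
        have : z - x = z.im * Complex.I := by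
          simp only [hx]; linear_combination -(Complex.re_add_im z)
        rw [this, mul_pow, Complex.I_sq]; push_cast; ring
      rw [h1, Complex.norm_real, Real.norm_eq_abs, abs_neg, abs_of_nonneg (by positivity)]
      nlinarith [sq_nonneg z.im]
  refine ⟨h 0, hne 0, fun z => ?_⟩
  rw [hFG z, entire_eq_of_ne_zero_of_norm_le hd hne (by positivity) (by positivity) hb2 z]

end EntireFunctions

/-! ### Cauchy data at one end determine the potential -/

section CauchyDataUniqueness

open Filter Topology ComplexConjugate

variable {q r : ℝ → ℝ} {a b : ℝ}

theorem exists_isSolutionOn_differentiable_right (hab : a ≤ b)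
    (hq : IntervalIntegrable q volume a b) (u₀ u₁ : ℂ) :
    ∃ y dy : ℂ → ℝ → ℂ,
      (∀ lam, IsSolutionOn q lam a b (y lam) (dy lam) ∧ y lam b = u₀ ∧ dy lam b = u₁) ∧
      ∀ x, Differentiable ℂ (fun lam => y lam x) ∧ Differentiable ℂ (fun lam => dy lam x) := by
  obtain ⟨c, dc, hc, hcd⟩ := exists_isSolutionOn_differentiable hab hq 1 0
  obtain ⟨s, ds, hs, hsd⟩ := exists_isSolutionOn_differentiable hab hq 0 1
  have hW : ∀ lam, c lam b * ds lam b - dc lam b * s lam b = 1 := fun lam => by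
    rw [(hc lam).1.wronskian_eq hab (hs lam).1 (right_mem_Icc.2 hab), (hc lam).2.1, (hc lam).2.2,
      (hs lam).2.1, (hs lam).2.2]
    ring
  refine ⟨fun lam x => (u₀ * ds lam b - u₁ * s lam b) * c lam x +
      (u₁ * c lam b - u₀ * dc lam b) * s lam x,
    fun lam x => (u₀ * ds lam b - u₁ * s lam b) * dc lam x +
      (u₁ * c lam b - u₀ * dc lam b) * ds lam x, fun lam => ⟨?_, ?_, ?_⟩, fun x => ⟨?_, ?_⟩⟩
  · exact ((hc lam).1.const_mul _).add ((hs lam).1.const_mul _)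
  · linear_combination u₀ * hW lam
  · linear_combination u₁ * hW lam
  · exact ((((hsd b).2.const_mul _).sub ((hsd b).1.const_mul _)).mul (hcd x).1).add
      ((((hcd b).1.const_mul _).sub ((hcd b).2.const_mul _)).mul (hsd x).1)
  · exact ((((hsd b).2.const_mul _).sub ((hsd b).1.const_mul _)).mul (hcd x).2).add
      ((((hcd b).1.const_mul _).sub ((hcd b).2.const_mul _)).mul (hsd x).2)

/-- These data annihilate `z' + κ z` at `b` and make `z' - κ z` equal to `-2 κ` there. Dividing by
`2 κ` leaves a constant independent of `κ`. -/
theorem IsSolutionOn.norm_le_of_decaying_data {lam κ : ℂ} {z dz : ℝ → ℂ} (hab : a ≤ b)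
    (hq : IntervalIntegrable q volume a b) (hz : IsSolutionOn q lam a b z dz)
    (hκ : κ ^ 2 = -lam) (hk : 0 < κ.re) (h0 : z b = 1) (h1 : dz b = -κ) {x : ℝ}
    (hx : x ∈ Icc a b) :
    ‖z x‖ ≤ 2 * Real.exp (κ.re * (b - x) + (∫ t in a..b, |q t|) / κ.re) := by
  have h := hz.factor_sq_add_le hab hq hκ hk hx
  have hκ0 : 0 < ‖κ‖ := norm_pos_iff.2 (by rintro rfl; simp at hk)
  have hb1 : dz b + κ * z b = 0 := by rw [h0, h1]; ring
  have hb2 : dz b - κ * z b = -(2 * κ) := by rw [h0, h1]; ring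
  rw [hb1, hb2, norm_zero, norm_neg, norm_mul, Complex.norm_two] at h
  have h2 : ‖2 * κ * z x‖ ^ 2 ≤ 2 * (‖dz x + κ * z x‖ ^ 2 + ‖dz x - κ * z x‖ ^ 2) := by
    have : 2 * κ * z x = (dz x + κ * z x) - (dz x - κ * z x) := by ring
    rw [this]
    refine le_trans ?_ IsSolutionOn.norm_add_norm_sq_le
    gcongr
    exact norm_sub_le _ _
  have h3 : Real.exp (2 * (κ.re * (b - x)) + 2 * ((∫ t in a..b, |q t|) / κ.re)) =
      Real.exp (κ.re * (b - x) + (∫ t in a..b, |q t|) / κ.re) ^ 2 := by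
    rw [← Real.exp_nat_mul]; congr 1; push_cast; ring
  rw [h3] at h
  rw [norm_mul, norm_mul, Complex.norm_two] at h2
  refine le_of_sq_le_sq ?_ (by positivity)
  have h4 : (2 * ‖κ‖) ^ 2 * ‖z x‖ ^ 2 ≤ (2 * ‖κ‖) ^ 2 *
      (2 * Real.exp (κ.re * (b - x) + (∫ t in a..b, |q t|) / κ.re)) ^ 2 := by
    nlinarith [sq_nonneg (2 * ‖κ‖ * Real.exp (κ.re * (b - x) + (∫ t in a..b, |q t|) / κ.re))]
  exact le_of_mul_le_mul_left h4 (by positivity)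

/-- With `z_i = u_i - κ v_i`, expanding `φ` and `ψ` in the fundamental systems at `b` gives `(u₁ v₂
- v₁ u₂)(φ' + κ φ)(b) = ψ z₁ - φ z₂`. The Weyl-type solutions carry `exp (-k (b - x)) / k` relative
to `|φ' + κ φ|(b)`, while the `z_i` carry at most `exp (k (b - x))`. The exponentials cancel and
`O(1/k)` remains. -/
theorem norm_cross_le {lam κ : ℂ} {u₁ du₁ v₁ dv₁ u₂ du₂ v₂ dv₂ φ dφ ψ dψ : ℝ → ℂ} (hab : a ≤ b)
    (hq : IntervalIntegrable q volume a b) (hr : IntervalIntegrable r volume a b)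
    (hu₁ : IsSolutionOn q lam a b u₁ du₁) (hv₁ : IsSolutionOn q lam a b v₁ dv₁)
    (hu₂ : IsSolutionOn r lam a b u₂ du₂) (hv₂ : IsSolutionOn r lam a b v₂ dv₂)
    (hφ : IsSolutionOn q lam a b φ dφ) (hψ : IsSolutionOn r lam a b ψ dψ)
    (hub₁ : u₁ b = 1 ∧ du₁ b = 0) (hvb₁ : v₁ b = 0 ∧ dv₁ b = 1)
    (hub₂ : u₂ b = 1 ∧ du₂ b = 0) (hvb₂ : v₂ b = 0 ∧ dv₂ b = 1)
    (hφs : lam.im * (conj (φ a) * dφ a).im ≤ 0) (hψs : lam.im * (conj (ψ a) * dψ a).im ≤ 0)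
    (hφψ : φ b = ψ b) (hφψ' : dφ b = dψ b) (hne : φ b ≠ 0 ∨ dφ b ≠ 0)
    (hκ : κ ^ 2 = -lam) (hk : 0 < κ.re) (hki : |κ.im| = κ.re) {x : ℝ} (hx : x ∈ Icc a b) :
    ‖u₁ x * v₂ x - v₁ x * u₂ x‖ ≤
      4 * Real.exp (((∫ t in a..b, |q t|) + ∫ t in a..b, |r t|) / κ.re) / κ.re := by
  have hbm : b ∈ Icc a b := right_mem_Icc.2 hab
  have eφ := (hφ.eqOn_of_eq hab hq ((hu₁.const_mul (φ b)).add (hv₁.const_mul (dφ b))) hbm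
    (by rw [hub₁.1, hvb₁.1]; ring) (by rw [hub₁.2, hvb₁.2]; ring)).1 hx
  have eψ := (hψ.eqOn_of_eq hab hr ((hu₂.const_mul (φ b)).add (hv₂.const_mul (dφ b))) hbm
    (by rw [hub₂.1, hvb₂.1, hφψ]; ring) (by rw [hub₂.2, hvb₂.2, hφψ']; ring)).1 hx
  have key : (u₁ x * v₂ x - v₁ x * u₂ x) * (dφ b + κ * φ b) =
      ψ x * (u₁ x + -κ * v₁ x) - φ x * (u₂ x + -κ * v₂ x) := by
    rw [eφ, eψ]; ring
  have hz₁ := (hu₁.add (hv₁.const_mul (-κ))).norm_le_of_decaying_data hab hq hκ hk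
    (by rw [hub₁.1, hvb₁.1]; ring) (by rw [hub₁.2, hvb₁.2]; ring) hx
  have hz₂ := (hu₂.add (hv₂.const_mul (-κ))).norm_le_of_decaying_data hab hr hκ hk
    (by rw [hub₂.1, hvb₂.1]; ring) (by rw [hub₂.2, hvb₂.2]; ring) hx
  have hP : 0 < ‖dφ b + κ * φ b‖ := by
    by_contra hc
    have h0 : ‖dφ b + κ * φ b‖ = 0 := le_antisymm (not_lt.1 hc) (norm_nonneg _)
    have h1 := IsSolutionOn.abs_im_mul_norm_le hκ hk (hφ.im_mul_im_nonpos hφs hbm)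
    rw [h0, hki] at h1
    have h2 : φ b = 0 := norm_le_zero_iff.1 (by nlinarith [norm_nonneg (φ b)])
    rw [h2, mul_zero, add_zero, norm_eq_zero] at h0
    tauto
  have hφx := (IsSolutionOn.abs_im_mul_norm_le hκ hk (hφ.im_mul_im_nonpos hφs hx)).trans
    (hφ.factor_le hab hq hκ hk hki hφs hx)
  have hψx := (IsSolutionOn.abs_im_mul_norm_le hκ hk (hψ.im_mul_im_nonpos hψs hx)).trans
    (hψ.factor_le hab hr hκ hk hki hψs hx)
  rw [← hφψ, ← hφψ'] at hψx
  rw [hki] at hφx hψx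
  set k := κ.re
  set P := ‖dφ b + κ * φ b‖
  set Q := ∫ t in a..b, |q t|
  set R := ∫ t in a..b, |r t|
  have e1 : Real.exp (-(k * (b - x)) + R / k) * Real.exp (k * (b - x) + Q / k) =
      Real.exp ((Q + R) / k) := by rw [← Real.exp_add]; congr 1; ring
  have e2 : Real.exp (-(k * (b - x)) + Q / k) * Real.exp (k * (b - x) + R / k) =
      Real.exp ((Q + R) / k) := by rw [← Real.exp_add]; congr 1; ring
  rw [le_div_iff₀ hk]
  refine le_of_mul_le_mul_right ?_ hP
  calc ‖u₁ x * v₂ x - v₁ x * u₂ x‖ * k * P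
      = k * ‖(u₁ x * v₂ x - v₁ x * u₂ x) * (dφ b + κ * φ b)‖ := by rw [norm_mul]; ring
    _ ≤ (k * ‖ψ x‖) * ‖u₁ x + -κ * v₁ x‖ + (k * ‖φ x‖) * ‖u₂ x + -κ * v₂ x‖ := by
        rw [key]
        have := norm_sub_le (ψ x * (u₁ x + -κ * v₁ x)) (φ x * (u₂ x + -κ * v₂ x))
        rw [norm_mul, norm_mul] at this
        nlinarith
    _ ≤ (P * Real.exp (-(k * (b - x)) + R / k)) * (2 * Real.exp (k * (b - x) + Q / k)) +
        (P * Real.exp (-(k * (b - x)) + Q / k)) * (2 * Real.exp (k * (b - x) + R / k)) := by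
        gcongr
    _ = 2 * P * (Real.exp (-(k * (b - x)) + R / k) * Real.exp (k * (b - x) + Q / k)) +
        2 * P * (Real.exp (-(k * (b - x)) + Q / k) * Real.exp (k * (b - x) + R / k)) := by ring
    _ = 4 * Real.exp ((Q + R) / k) * P := by rw [e1, e2]; ring

/-- The cross term and its derivative vanish, so `u₁ = e u₂` and `v₁ = e v₂` with `e = u₁ v₂' - v₁
u₂'`, and the Wronskians give `e² = 1`. By continuity and `e b = 1`, `e` is identically `1`. The
equations then yield `(q - r) u₁ = (q - r) v₁ = 0`, and `u₁`, `v₁` have no common zero. -/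
theorem potential_ae_eq_of_cross_eq_zero {u₁ du₁ v₁ dv₁ u₂ du₂ v₂ dv₂ : ℝ → ℂ} {lam : ℂ}
    (hab : a < b)
    (hu₁ : IsSolutionOn q lam a b u₁ du₁) (hv₁ : IsSolutionOn q lam a b v₁ dv₁)
    (hu₂ : IsSolutionOn r lam a b u₂ du₂) (hv₂ : IsSolutionOn r lam a b v₂ dv₂)
    (hW₁ : ∀ x ∈ Icc a b, u₁ x * dv₁ x - du₁ x * v₁ x = 1)
    (hW₂ : ∀ x ∈ Icc a b, u₂ x * dv₂ x - du₂ x * v₂ x = 1)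
    (hb : u₁ b * dv₂ b - v₁ b * du₂ b = 1)
    (hD : ∀ x ∈ Icc a b, u₁ x * v₂ x - v₁ x * u₂ x = 0) :
    ∀ᵐ x, x ∈ Icc a b → q x = r x := by
  set e : ℝ → ℂ := fun x => u₁ x * dv₂ x - v₁ x * du₂ x with he
  have hD' : ∀ x ∈ Icc a b,
      (du₁ x * v₂ x + u₁ x * dv₂ x) - (dv₁ x * u₂ x + v₁ x * du₂ x) = 0 := by
    intro x hx
    have h1 := ((hu₁.hasDeriv x hx).fun_mul (hv₂.hasDeriv x hx)).fun_sub
      ((hv₁.hasDeriv x hx).fun_mul (hu₂.hasDeriv x hx))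
    have h2 : HasDerivWithinAt (fun x => u₁ x * v₂ x - v₁ x * u₂ x) 0 (Icc a b) x :=
      (hasDerivWithinAt_const x _ (0 : ℂ)).congr_of_mem (fun y hy => hD y hy) hx
    exact (uniqueDiffOn_Icc hab x hx).eq_deriv _ h1 h2
  have hu : ∀ x ∈ Icc a b, u₁ x = e x * u₂ x := fun x hx => by
    simp only [he]; linear_combination (-u₁ x) * hW₂ x hx - du₂ x * hD x hx
  have hv : ∀ x ∈ Icc a b, v₁ x = e x * v₂ x := fun x hx => by
    simp only [he]; linear_combination (-v₁ x) * hW₂ x hx - dv₂ x * hD x hx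
  have hsq : ∀ x ∈ Icc a b, e x ^ 2 = 1 := fun x hx => by
    have h1 := hD' x hx
    have h2 := hu x hx
    have h3 := hv x hx
    have h4 := hW₁ x hx
    have h5 : e x = dv₁ x * u₂ x - du₁ x * v₂ x := by simp only [he]; linear_combination h1
    calc e x ^ 2 = e x * e x := sq _
      _ = (e x * u₂ x) * dv₁ x - du₁ x * (e x * v₂ x) := by nth_rewrite 2 [h5]; ring
      _ = 1 := by rw [← h2, ← h3, h4]
  have hec : ContinuousOn e (Icc a b) :=
    (hu₁.continuousOn.mul (hv₂.continuousOn_deriv hab.le)).sub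
      (hv₁.continuousOn.mul (hu₂.continuousOn_deriv hab.le))
  have hbm : b ∈ Icc a b := right_mem_Icc.2 hab.le
  have he1 : ∀ x ∈ Icc a b, e x = 1 := by
    have := isPreconnected_Icc.eq_or_eq_neg_of_sq_eq hec (continuousOn_const (c := (1 : ℂ)))
      (fun x hx => by simpa using hsq x hx) (fun _ => one_ne_zero)
    rcases this with h | h
    · exact fun x hx => h hx
    · have h1 : e b = -1 := h hbm
      rw [show e b = 1 from hb] at h1
      norm_num at h1
  have huu : EqOn u₁ u₂ (Icc a b) := fun x hx => by rw [hu x hx, he1 x hx, one_mul]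
  have hvv : EqOn v₁ v₂ (Icc a b) := fun x hx => by rw [hv x hx, he1 x hx, one_mul]
  have hder : ∀ {y dy z dz : ℝ → ℂ}, IsSolutionOn q lam a b y dy → IsSolutionOn r lam a b z dz →
      EqOn y z (Icc a b) → ∀ᵐ x, x ∈ Icc a b → (q x : ℂ) * y x = r x * y x := by
    intro y dy z dz hy hz hyz
    have hdd : EqOn dy dz (Icc a b) := fun x hx =>
      (uniqueDiffOn_Icc hab x hx).eq_deriv _ (hy.hasDeriv x hx)
        ((hz.hasDeriv x hx).congr_of_mem (fun t ht => hyz ht) hx)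
    filter_upwards [hy.ode, hz.ode] with x h1 h2 h3
    have h4 := (uniqueDiffOn_Icc hab x h3).eq_deriv _ (h1 h3).hasDerivWithinAt
      ((h2 h3).hasDerivWithinAt.congr_of_mem (fun t ht => hdd ht) h3)
    rw [← hyz h3] at h4
    linear_combination h4
  filter_upwards [hder hu₁ hu₂ huu, hder hv₁ hv₂ hvv] with x h1 h2 h3
  have h4 : (q x : ℂ) = r x := by
    linear_combination (r x - q x : ℂ) * hW₁ x h3 + dv₁ x * h1 h3 - du₁ x * h2 h3
  exact_mod_cast h4

/-- Two potentials on `[a, b]` agree if they admit, for all spectral parameters, nontrivial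
solutions which are of Weyl type at `a` and have the same Cauchy data at `b`. -/
theorem potential_ae_eq_of_cauchy_data_eq (hab : a < b) (hq : IntervalIntegrable q volume a b)
    (hr : IntervalIntegrable r volume a b) {φ dφ ψ dψ : ℂ → ℝ → ℂ}
    (hφ : ∀ lam, IsSolutionOn q lam a b (φ lam) (dφ lam))
    (hψ : ∀ lam, IsSolutionOn r lam a b (ψ lam) (dψ lam))
    (hφs : ∀ lam, lam.im * (conj (φ lam a) * dφ lam a).im ≤ 0)
    (hψs : ∀ lam, lam.im * (conj (ψ lam a) * dψ lam a).im ≤ 0)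
    (hne : ∀ lam, φ lam b ≠ 0 ∨ dφ lam b ≠ 0)
    (hb : ∀ lam, φ lam b = ψ lam b) (hb' : ∀ lam, dφ lam b = dψ lam b) :
    ∀ᵐ x, x ∈ Icc a b → q x = r x := by
  have hab' := hab.le
  have hbm : b ∈ Icc a b := right_mem_Icc.2 hab'
  obtain ⟨u₁, du₁, hu₁, hud₁⟩ := exists_isSolutionOn_differentiable_right hab' hq 1 0
  obtain ⟨v₁, dv₁, hv₁, hvd₁⟩ := exists_isSolutionOn_differentiable_right hab' hq 0 1
  obtain ⟨u₂, du₂, hu₂, hud₂⟩ := exists_isSolutionOn_differentiable_right hab' hr 1 0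
  obtain ⟨v₂, dv₂, hv₂, hvd₂⟩ := exists_isSolutionOn_differentiable_right hab' hr 0 1
  obtain ⟨C₁, -, hle₁⟩ := IsSolutionOn.exists_norm_le hab' hq
  obtain ⟨C₂, -, hle₂⟩ := IsSolutionOn.exists_norm_le hab' hr
  have wronsk : ∀ {q : ℝ → ℝ} {lam : ℂ} {y dy z dz : ℝ → ℂ}, IsSolutionOn q lam a b y dy →
      IsSolutionOn q lam a b z dz → y b * dz b - dy b * z b = 1 →
      ∀ x ∈ Icc a b, y x * dz x - dy x * z x = 1 := by
    intro q lam y dy z dz hy hz h x hx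
    rw [hy.wronskian_eq hab' hz hx, ← hy.wronskian_eq hab' hz hbm, h]
  have hD : ∀ x ∈ Icc a b, ∀ lam, u₁ lam x * v₂ lam x - v₁ lam x * u₂ lam x = 0 := by
    intro x hx lam
    set T := (∫ t in a..b, |q t|) + ∫ t in a..b, |r t| with hT
    have hlim : Tendsto (fun k : ℝ => 4 * Real.exp (T / k) / k) atTop (𝓝 0) := by
      have h1 : Tendsto (fun k : ℝ => k⁻¹) atTop (𝓝 0) := tendsto_inv_atTop_zero
      have h2 : Tendsto (fun k : ℝ => Real.exp (T * k⁻¹)) atTop (𝓝 (Real.exp (T * 0))) :=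
        (Real.continuous_exp.tendsto _).comp (h1.const_mul T)
      have h3 := (h2.const_mul 4).mul h1
      rw [mul_zero] at h3
      exact h3.congr fun k => by rw [div_eq_mul_inv, div_eq_mul_inv]
    have cross : ∀ (lam κ : ℂ), κ ^ 2 = -lam → 0 < κ.re → |κ.im| = κ.re →
        ‖u₁ lam x * v₂ lam x - v₁ lam x * u₂ lam x‖ ≤ 4 * Real.exp (T / κ.re) / κ.re :=
      fun lam κ hκ hk hki => norm_cross_le hab' hq hr (hu₁ lam).1 (hv₁ lam).1 (hu₂ lam).1
        (hv₂ lam).1 (hφ lam) (hψ lam) (hu₁ lam).2 (hv₁ lam).2 (hu₂ lam).2 (hv₂ lam).2 (hφs lam)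
        (hψs lam) (hb lam) (hb' lam) (hne lam) hκ hk hki hx
    refine entire_eq_zero_of_tendsto_zero_imaginary (K := 2) (C := C₁ + C₂)
      (D := fun lam => u₁ lam x * v₂ lam x - v₁ lam x * u₂ lam x)
      (((hud₁ x).1.mul (hvd₂ x).1).sub ((hvd₁ x).1.mul (hud₂ x).1)) ?_ ?_ ?_ lam
    · intro lam
      have bound : ∀ {C : ℝ} {y dy : ℝ → ℂ}, ‖y x‖ + ‖dy x‖ ≤ (‖y b‖ + ‖dy b‖) *
          Real.exp (C * (1 + √‖lam‖)) → ‖y b‖ + ‖dy b‖ = 1 →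
          ‖y x‖ ≤ Real.exp (C * (1 + √‖lam‖)) := by
        intro C y dy h h'
        rw [h', one_mul] at h
        linarith [norm_nonneg (dy x)]
      have h1 := bound (hle₁ lam _ _ (hu₁ lam).1 b hbm x hx) (by simp [(hu₁ lam).2])
      have h2 := bound (hle₁ lam _ _ (hv₁ lam).1 b hbm x hx) (by simp [(hv₁ lam).2])
      have h3 := bound (hle₂ lam _ _ (hu₂ lam).1 b hbm x hx) (by simp [(hu₂ lam).2])
      have h4 := bound (hle₂ lam _ _ (hv₂ lam).1 b hbm x hx) (by simp [(hv₂ lam).2])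
      refine (norm_sub_le _ _).trans ?_
      rw [norm_mul, norm_mul, add_mul, Real.exp_add]
      have h5 : ‖u₁ lam x‖ * ‖v₂ lam x‖ ≤
        Real.exp (C₁ * (1 + √‖lam‖)) * Real.exp (C₂ * (1 + √‖lam‖)) := by gcongr
      have h6 : ‖v₁ lam x‖ * ‖u₂ lam x‖ ≤
        Real.exp (C₁ * (1 + √‖lam‖)) * Real.exp (C₂ * (1 + √‖lam‖)) := by gcongr
      linarith
    · refine squeeze_zero_norm' ?_ hlim
      filter_upwards [eventually_gt_atTop 0] with k hk
      -- `k (1 - i)` is the square root of `-lam` with positive real part; its real and imaginary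
      -- parts have equal modulus, as the estimates require. On the other half-axis the root is `k
      -- (1 + i)`.
      have h := cross (2 * k ^ 2 * Complex.I) (k * (1 - Complex.I))
        (by linear_combination (k : ℂ) ^ 2 * Complex.I_sq) (by simpa using hk)
        (by simp [abs_of_pos hk])
      simpa using h
    · refine squeeze_zero_norm' ?_ hlim
      filter_upwards [eventually_gt_atTop 0] with k hk
      have h := cross (-(2 * k ^ 2 * Complex.I)) (k * (1 + Complex.I))
        (by linear_combination (k : ℂ) ^ 2 * Complex.I_sq) (by simpa using hk)
        (by simp [abs_of_pos hk])
      simpa using h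
  -- Once the cross term vanishes for all parameters, a single one suffices.
  refine potential_ae_eq_of_cross_eq_zero (lam := 0) hab (hu₁ 0).1 (hv₁ 0).1 (hu₂ 0).1 (hv₂ 0).1
    (wronsk (hu₁ 0).1 (hv₁ 0).1 ?_) (wronsk (hu₂ 0).1 (hv₂ 0).1 ?_) ?_ (fun x hx => hD x hx 0)
  · simp [(hu₁ 0).2, (hv₁ 0).2]
  · simp [(hu₂ 0).2, (hv₂ 0).2]
  · simp [(hu₁ 0).2, (hv₁ 0).2, (hv₂ 0).2]

end CauchyDataUniqueness

/-! ### The transfer problem and its characteristic function -/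

section TransferProblem

open Filter Topology ComplexConjugate

/-- A family of solutions, depending on the spectral parameter, of the transfer problem with the
boundary condition at `-S`, normalised at `-S`, with Cauchy data at `S` entire in the parameter. -/
structure IsTransferFamily (S : ℝ) (q : ℝ → ℝ) (M : Matrix (Fin 2) (Fin 2) ℝ) (α : ℝ)
    (yL dyL yR dyR : ℂ → ℝ → ℂ) : Prop where
  left : ∀ lam, IsSolutionOn q lam (-S) 0 (yL lam) (dyL lam)
  right : ∀ lam, IsSolutionOn q lam 0 S (yR lam) (dyR lam)
  left_val : ∀ lam, yL lam (-S) = (Real.sin α : ℂ)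
  left_deriv : ∀ lam, dyL lam (-S) = (Real.cos α : ℂ)
  transfer_val : ∀ lam, yR lam 0 = (M 0 0 : ℂ) * yL lam 0 + (M 0 1 : ℂ) * dyL lam 0
  transfer_deriv : ∀ lam, dyR lam 0 = (M 1 0 : ℂ) * yL lam 0 + (M 1 1 : ℂ) * dyL lam 0
  differentiable_val : Differentiable ℂ (fun lam => yR lam S)
  differentiable_deriv : Differentiable ℂ (fun lam => dyR lam S)

variable {S : ℝ} {q r : ℝ → ℝ} {M : Matrix (Fin 2) (Fin 2) ℝ} {α β : ℝ}
  {yL dyL yR dyR zL dzL zR dzR : ℂ → ℝ → ℂ}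

theorem exists_isTransferFamily (hS : 0 ≤ S) (hqL : IntervalIntegrable q volume (-S) 0)
    (hqR : IntervalIntegrable q volume 0 S) (M : Matrix (Fin 2) (Fin 2) ℝ) (α : ℝ) :
    ∃ yL dyL yR dyR, IsTransferFamily S q M α yL dyL yR dyR := by
  obtain ⟨y, dy, hy, hyd⟩ := exists_isSolutionOn_differentiable (neg_nonpos.2 hS) hqL
    (Real.sin α : ℂ) (Real.cos α : ℂ)
  obtain ⟨c, dc, hc, hcd⟩ := exists_isSolutionOn_differentiable hS hqR 1 0
  obtain ⟨s, ds, hs, hsd⟩ := exists_isSolutionOn_differentiable hS hqR 0 1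
  have hA : ∀ i, Differentiable ℂ (fun lam => (M i 0 : ℂ) * y lam 0 + (M i 1 : ℂ) * dy lam 0) :=
    fun i => ((hyd 0).1.const_mul _).add ((hyd 0).2.const_mul _)
  refine ⟨y, dy,
    fun lam x => ((M 0 0 : ℂ) * y lam 0 + (M 0 1 : ℂ) * dy lam 0) * c lam x +
      ((M 1 0 : ℂ) * y lam 0 + (M 1 1 : ℂ) * dy lam 0) * s lam x,
    fun lam x => ((M 0 0 : ℂ) * y lam 0 + (M 0 1 : ℂ) * dy lam 0) * dc lam x +
      ((M 1 0 : ℂ) * y lam 0 + (M 1 1 : ℂ) * dy lam 0) * ds lam x,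
    fun lam => (hy lam).1, fun lam => ((hc lam).1.const_mul _).add ((hs lam).1.const_mul _),
    fun lam => (hy lam).2.1, fun lam => (hy lam).2.2, fun lam => ?_, fun lam => ?_,
    ((hA 0).mul (hcd S).1).add ((hA 1).mul (hsd S).1),
    ((hA 0).mul (hcd S).2).add ((hA 1).mul (hsd S).2)⟩
  · rw [(hc lam).2.1, (hs lam).2.1]; ring
  · rw [(hc lam).2.2, (hs lam).2.2]; ring

theorem sin_sq_add_cos_sq_ofReal (t : ℝ) :
    (Real.sin t : ℂ) ^ 2 + (Real.cos t : ℂ) ^ 2 = 1 := by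
  exact_mod_cast Real.sin_sq_add_cos_sq t

theorem det_fin_two_ofReal_ne_zero (hM : 0 < M.det) :
    (M 0 0 : ℂ) * M 1 1 - (M 0 1 : ℂ) * M 1 0 ≠ 0 := by
  rw [Matrix.det_fin_two] at hM
  exact_mod_cast hM.ne'

theorem eq_of_matrix_fin_two_eq (hM : 0 < M.det) {u v u' v' : ℂ}
    (h : (M 0 0 : ℂ) * u + (M 0 1 : ℂ) * v = (M 0 0 : ℂ) * u' + (M 0 1 : ℂ) * v')
    (h' : (M 1 0 : ℂ) * u + (M 1 1 : ℂ) * v = (M 1 0 : ℂ) * u' + (M 1 1 : ℂ) * v') :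
    u = u' ∧ v = v' := by
  have hd := det_fin_two_ofReal_ne_zero hM
  constructor <;> refine sub_eq_zero.1 ((mul_eq_zero.1 ?_).resolve_left hd)
  · linear_combination (M 1 1 : ℂ) * h - (M 0 1 : ℂ) * h'
  · linear_combination (M 0 0 : ℂ) * h' - (M 1 0 : ℂ) * h

namespace IsTransferFamily

theorem mem_transferSpectrum_iff (hS : 0 < S) (hqL : IntervalIntegrable q volume (-S) 0)
    (hqR : IntervalIntegrable q volume 0 S) (h : IsTransferFamily S q M α yL dyL yR dyR) (lam : ℂ) :
    lam ∈ transferSpectrum S q M α β ↔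
      yR lam S * (Real.cos β : ℂ) - dyR lam S * (Real.sin β : ℂ) = 0 := by
  have hS' : -S ≤ 0 := neg_nonpos.2 hS.le
  have hα := sin_sq_add_cos_sq_ofReal α
  constructor
  · rintro ⟨z, dz, w, dw, hz⟩
    -- The component of the data at `-S` along `(sin α, cos α)`. The boundary condition kills the
    -- orthogonal component, so the eigenfunction is `t` times the normalised solution.
    set t : ℂ := z (-S) * (Real.sin α : ℂ) + dz (-S) * (Real.cos α : ℂ) with ht
    have hbc := hz.bc_left
    have eL := hz.left.eqOn_of_eq hS' hqL ((h.left lam).const_mul t) (left_mem_Icc.2 hS')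
      (by rw [h.left_val, ht]; linear_combination (-z (-S)) * hα + (Real.cos α : ℂ) * hbc)
      (by rw [h.left_deriv, ht]; linear_combination (-dz (-S)) * hα - (Real.sin α : ℂ) * hbc)
    have e0 := eL.1 (right_mem_Icc.2 hS')
    have e0' := eL.2 (right_mem_Icc.2 hS')
    have eR := hz.right.eqOn_of_eq hS.le hqR ((h.right lam).const_mul t) (left_mem_Icc.2 hS.le)
      (by rw [h.transfer_val, hz.transfer_val, e0, e0']; ring)
      (by rw [h.transfer_deriv, hz.transfer_deriv, e0, e0']; ring)
    have ht0 : t ≠ 0 := by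
      intro h0
      rcases hz.nontrivial with ⟨x, hx, hne⟩ | ⟨x, hx, hne⟩
      · exact hne (by simpa [h0] using eL.1 hx)
      · exact hne (by simpa [h0] using eR.1 hx)
    have hbr := hz.bc_right
    rw [eR.1 (right_mem_Icc.2 hS.le), eR.2 (right_mem_Icc.2 hS.le)] at hbr
    refine (mul_eq_zero.1 (?_ : t * _ = 0)).resolve_left ht0
    linear_combination hbr
  · intro hF
    refine ⟨yL lam, dyL lam, yR lam, dyR lam, h.left lam, h.right lam, h.transfer_val lam,
      h.transfer_deriv lam, ?_, hF, Or.inl ?_⟩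
    · rw [h.left_val, h.left_deriv]; ring
    · by_contra hc
      push Not at hc
      have hm : -S ∈ Icc (-S) 0 := left_mem_Icc.2 hS'
      have h1 : HasDerivWithinAt (yL lam) 0 (Icc (-S) 0) (-S) :=
        (hasDerivWithinAt_const _ _ (0 : ℂ)).congr_of_mem hc hm
      have h2 := (uniqueDiffOn_Icc (neg_lt_zero.2 hS) _ hm).eq_deriv _
        ((h.left lam).hasDeriv _ hm) h1
      have h3 := hc _ hm
      rw [h.left_val] at h3
      rw [h.left_deriv] at h2
      rw [h2, h3] at hα
      norm_num at hα

theorem left_sign (h : IsTransferFamily S q M α yL dyL yR dyR) (lam : ℂ) :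
    (conj (yL lam (-S)) * dyL lam (-S)).im = 0 := by
  rw [h.left_val, h.left_deriv, Complex.conj_ofReal, ← Complex.ofReal_mul, Complex.ofReal_im]

/-- A real matrix multiplies the symplectic form by its determinant. This is where `det M > 0` acts:
the Weyl sign is kept across the transfer point. -/
theorem im_transfer (h : IsTransferFamily S q M α yL dyL yR dyR) (lam : ℂ) :
    (conj (yR lam 0) * dyR lam 0).im = M.det * (conj (yL lam 0) * dyL lam 0).im := by
  rw [h.transfer_val, h.transfer_deriv, Matrix.det_fin_two]
  simp only [map_add, map_mul, Complex.conj_ofReal, Complex.add_im, Complex.add_re,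
    Complex.mul_im, Complex.mul_re, Complex.conj_re, Complex.conj_im, Complex.ofReal_re,
    Complex.ofReal_im]
  ring

theorem right_sign (hS : 0 < S) (hM : 0 < M.det) (h : IsTransferFamily S q M α yL dyL yR dyR)
    (lam : ℂ) : lam.im * (conj (yR lam 0) * dyR lam 0).im ≤ 0 := by
  have h1 := (h.left lam).im_mul_im_nonpos (by rw [h.left_sign, mul_zero])
    (right_mem_Icc.2 (neg_nonpos.2 hS.le))
  rw [h.im_transfer]
  nlinarith

theorem left_ne_zero (hS : 0 < S) (hqL : IntervalIntegrable q volume (-S) 0)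
    (h : IsTransferFamily S q M α yL dyL yR dyR) (lam : ℂ) : yL lam 0 ≠ 0 ∨ dyL lam 0 ≠ 0 := by
  have hS' : -S ≤ 0 := neg_nonpos.2 hS.le
  by_contra hc
  push Not at hc
  have e := (h.left lam).eqOn_of_eq hS' hqL ((h.left lam).const_mul 0) (right_mem_Icc.2 hS')
    (by rw [hc.1, mul_zero]) (by rw [hc.2, mul_zero])
  have h1 := e.1 (left_mem_Icc.2 hS')
  have h2 := e.2 (left_mem_Icc.2 hS')
  simp only [zero_mul] at h1 h2
  rw [h.left_val] at h1
  rw [h.left_deriv] at h2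
  have hα := sin_sq_add_cos_sq_ofReal α
  rw [h1, h2] at hα
  norm_num at hα

theorem right_ne_zero (hS : 0 < S) (hqL : IntervalIntegrable q volume (-S) 0)
    (hqR : IntervalIntegrable q volume 0 S) (hM : 0 < M.det)
    (h : IsTransferFamily S q M α yL dyL yR dyR) (lam : ℂ) : yR lam S ≠ 0 ∨ dyR lam S ≠ 0 := by
  by_contra hc
  push Not at hc
  have e := (h.right lam).eqOn_of_eq hS.le hqR ((h.right lam).const_mul 0) (right_mem_Icc.2 hS.le)
    (by rw [hc.1, mul_zero]) (by rw [hc.2, mul_zero])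
  have h1 := e.1 (left_mem_Icc.2 hS.le)
  have h2 := e.2 (left_mem_Icc.2 hS.le)
  simp only [zero_mul] at h1 h2
  rw [h.transfer_val] at h1
  rw [h.transfer_deriv] at h2
  have h3 := eq_of_matrix_fin_two_eq hM (u' := 0) (v' := 0) (by rw [h1]; ring) (by rw [h2]; ring)
  rcases h.left_ne_zero hS hqL lam with h4 | h4
  · exact h4 h3.1
  · exact h4 h3.2

theorem exists_norm_le (hS : 0 < S) (hqL : IntervalIntegrable q volume (-S) 0)
    (hqR : IntervalIntegrable q volume 0 S) (h : IsTransferFamily S q M α yL dyL yR dyR) :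
    ∃ K > 0, ∃ C > 0, ∀ lam,
      ‖yR lam S‖ + ‖dyR lam S‖ ≤ K * Real.exp (C * (1 + √‖lam‖)) := by
  have hS' : -S ≤ 0 := neg_nonpos.2 hS.le
  obtain ⟨C₁, hC₁, h₁⟩ := IsSolutionOn.exists_norm_le hS' hqL
  obtain ⟨C₂, hC₂, h₂⟩ := IsSolutionOn.exists_norm_le hS.le hqR
  set m := |M 0 0| + |M 0 1| + |M 1 0| + |M 1 1| with hm
  refine ⟨2 * m + 1, by positivity, C₁ + C₂, by positivity, fun lam => ?_⟩
  have e1 := h₁ lam _ _ (h.left lam) _ (left_mem_Icc.2 hS') _ (right_mem_Icc.2 hS')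
  have e2 := h₂ lam _ _ (h.right lam) _ (left_mem_Icc.2 hS.le) _ (right_mem_Icc.2 hS.le)
  rw [h.left_val, h.left_deriv, Complex.norm_real, Complex.norm_real, Real.norm_eq_abs,
    Real.norm_eq_abs] at e1
  have e3 : ‖yR lam 0‖ + ‖dyR lam 0‖ ≤ m * (‖yL lam 0‖ + ‖dyL lam 0‖) := by
    have i1 : ‖yR lam 0‖ ≤ |M 0 0| * ‖yL lam 0‖ + |M 0 1| * ‖dyL lam 0‖ := by
      rw [h.transfer_val]
      refine (norm_add_le _ _).trans (le_of_eq ?_)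
      simp
    have i2 : ‖dyR lam 0‖ ≤ |M 1 0| * ‖yL lam 0‖ + |M 1 1| * ‖dyL lam 0‖ := by
      rw [h.transfer_deriv]
      refine (norm_add_le _ _).trans (le_of_eq ?_)
      simp
    have j1 : 0 ≤ (|M 0 0| + |M 1 0|) * ‖dyL lam 0‖ := by positivity
    have j2 : 0 ≤ (|M 0 1| + |M 1 1|) * ‖yL lam 0‖ := by positivity
    rw [hm]; linarith
  set ω := 1 + √‖lam‖ with hω
  have e4 : |Real.sin α| + |Real.cos α| ≤ 2 := by
    linarith [Real.abs_sin_le_one α, Real.abs_cos_le_one α]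
  calc ‖yR lam S‖ + ‖dyR lam S‖ ≤ (m * (2 * Real.exp (C₁ * ω))) * Real.exp (C₂ * ω) := by
        refine e2.trans ?_
        gcongr
        refine e3.trans ?_
        gcongr
        exact e1.trans (by gcongr)
    _ = 2 * m * Real.exp ((C₁ + C₂) * ω) := by
        rw [show (C₁ + C₂) * ω = C₁ * ω + C₂ * ω by ring, Real.exp_add]; ring
    _ ≤ _ := by gcongr; linarith

/-- Rotating `(u, v) = (y, y')(S)` by `β` to `(F, H)` preserves `Im (ū v)`, so `|F| |H| ≥ |Im (ū
v)|`. By Lagrange's identity on both halves the right side is `|Im lam| (det M ∫ |yL|² + ∫ |yR|²)`.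
The left integral is bounded below by `exists_le_integral_norm_sq` and `|H|` is bounded above by the
growth estimate. -/
theorem exists_le_norm (hS : 0 < S) (hqL : IntervalIntegrable q volume (-S) 0)
    (hqR : IntervalIntegrable q volume 0 S) (hM : 0 < M.det)
    (h : IsTransferFamily S q M α yL dyL yR dyR) :
    ∃ c > 0, ∃ C > 0, ∀ (β : ℝ) (lam : ℂ), c * |lam.im| * Real.exp (-(C * (1 + √‖lam‖))) ≤
      ‖yR lam S * (Real.cos β : ℂ) - dyR lam S * (Real.sin β : ℂ)‖ := by
  obtain ⟨K, hK, C₁, hC₁, hup⟩ := h.exists_norm_le hS hqL hqR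
  obtain ⟨c, hc, C₂, hC₂, hlow⟩ := IsSolutionOn.exists_le_integral_norm_sq (neg_lt_zero.2 hS) hqL
  refine ⟨M.det * c / K, by positivity, C₁ + C₂, by positivity, fun β lam => ?_⟩
  set u := yR lam S
  set v := dyR lam S
  set F := u * (Real.cos β : ℂ) - v * (Real.sin β : ℂ) with hF
  set H := u * (Real.sin β : ℂ) + v * (Real.cos β : ℂ) with hH
  set ω := 1 + √‖lam‖ with hω
  have e1 := (h.left lam).im_conj_mul_deriv_sub (neg_nonpos.2 hS.le)
  have e2 := (h.right lam).im_conj_mul_deriv_sub hS.le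
  rw [h.left_sign, sub_zero] at e1
  rw [h.im_transfer, e1] at e2
  have e3 : c * Real.exp (-(C₂ * ω)) ≤ ∫ x in (-S)..0, ‖yL lam x‖ ^ 2 := by
    refine hlow lam _ _ (-(Real.cos α : ℂ)) (Real.sin α : ℂ) (h.left lam) ?_ ?_
    · rw [h.left_val, h.left_deriv]; linear_combination sin_sq_add_cos_sq_ofReal α
    · rw [norm_neg, Complex.norm_real, Complex.norm_real, Real.norm_eq_abs, Real.norm_eq_abs]
      linarith [Real.abs_sin_le_one α, Real.abs_cos_le_one α]
  have e4 : 0 ≤ ∫ x in (0 : ℝ)..S, ‖yR lam x‖ ^ 2 :=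
    intervalIntegral.integral_nonneg hS.le fun _ _ => by positivity
  have e5 : |(conj u * v).im| = |lam.im| * (M.det * (∫ x in (-S)..0, ‖yL lam x‖ ^ 2) +
      ∫ x in (0 : ℝ)..S, ‖yR lam x‖ ^ 2) := by
    have : (conj u * v).im = -lam.im * (M.det * (∫ x in (-S)..0, ‖yL lam x‖ ^ 2) +
      ∫ x in (0 : ℝ)..S, ‖yR lam x‖ ^ 2) := by linarith
    rw [this, abs_mul, abs_neg, abs_of_nonneg (a := M.det * _ + _)]
    have : 0 ≤ ∫ x in (-S)..0, ‖yL lam x‖ ^ 2 := le_trans (by positivity) e3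
    positivity
  have e6 : (conj u * v).im = (conj F * H).im := by
    have hβ := Real.sin_sq_add_cos_sq β
    simp only [hF, hH, map_sub, map_mul, Complex.conj_ofReal, Complex.add_im, Complex.add_re,
      Complex.sub_re, Complex.sub_im, Complex.mul_im, Complex.mul_re, Complex.conj_re,
      Complex.conj_im, Complex.ofReal_re, Complex.ofReal_im]
    linear_combination (-(u.re * v.im) + u.im * v.re) * hβ
  have e7 : ‖H‖ ≤ K * Real.exp (C₁ * ω) := by
    refine le_trans ?_ (hup lam)
    refine (norm_add_le _ _).trans ?_
    rw [norm_mul, norm_mul, Complex.norm_real, Complex.norm_real, Real.norm_eq_abs,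
      Real.norm_eq_abs]
    gcongr
    · exact mul_le_of_le_one_right (norm_nonneg _) (Real.abs_sin_le_one β)
    · exact mul_le_of_le_one_right (norm_nonneg _) (Real.abs_cos_le_one β)
  have e8 : |lam.im| * (M.det * (c * Real.exp (-(C₂ * ω)))) ≤ ‖F‖ * (K * Real.exp (C₁ * ω)) := by
    calc _ ≤ |(conj u * v).im| := by
          rw [e5]
          gcongr
          have : M.det * (c * Real.exp (-(C₂ * ω))) ≤
            M.det * ∫ x in (-S)..0, ‖yL lam x‖ ^ 2 := by gcongr
          linarith
      _ ≤ ‖conj F * H‖ := by rw [e6]; exact Complex.abs_im_le_norm _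
      _ = ‖F‖ * ‖H‖ := by rw [norm_mul, RCLike.norm_conj]
      _ ≤ _ := by gcongr
  have e9 : Real.exp (-((C₁ + C₂) * ω)) = Real.exp (-(C₂ * ω)) / Real.exp (C₁ * ω) := by
    rw [← Real.exp_sub]; congr 1; ring
  rw [e9]
  calc M.det * c / K * |lam.im| * (Real.exp (-(C₂ * ω)) / Real.exp (C₁ * ω))
      = |lam.im| * (M.det * (c * Real.exp (-(C₂ * ω)))) / (K * Real.exp (C₁ * ω)) := by
        field_simp
    _ ≤ ‖F‖ := by rw [div_le_iff₀ (by positivity)]; exact e8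

end IsTransferFamily

end TransferProblem

/-! ### From two spectra to the potential -/

section TwoSpectra

open Filter Topology ComplexConjugate

variable {S : ℝ} {q r : ℝ → ℝ} {M : Matrix (Fin 2) (Fin 2) ℝ} {α β : ℝ}
  {yL dyL yR dyR zL dzL zR dzR : ℂ → ℝ → ℂ}

namespace IsTransferFamily

theorem exists_proportional (hS : 0 < S) (hqL : IntervalIntegrable q volume (-S) 0)
    (hqR : IntervalIntegrable q volume 0 S) (hrL : IntervalIntegrable r volume (-S) 0)
    (hrR : IntervalIntegrable r volume 0 S) (hM : 0 < M.det)
    (hy : IsTransferFamily S q M α yL dyL yR dyR) (hz : IsTransferFamily S r M α zL dzL zR dzR)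
    (hspec : transferSpectrum S q M α β = transferSpectrum S r M α β) :
    ∃ c₀ : ℂ, c₀ ≠ 0 ∧ ∀ lam, yR lam S * (Real.cos β : ℂ) - dyR lam S * (Real.sin β : ℂ) =
      c₀ * (zR lam S * (Real.cos β : ℂ) - dzR lam S * (Real.sin β : ℂ)) := by
  obtain ⟨K, hK, C₁, hC₁, hup⟩ := hy.exists_norm_le hS hqL hqR
  obtain ⟨c₂, hc₂, C₂, hC₂, hlow₂⟩ := hy.exists_le_norm hS hqL hqR hM
  obtain ⟨c₃, hc₃, C₃, hC₃, hlow₃⟩ := hz.exists_le_norm hS hrL hrR hM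
  have weaken : ∀ {c C : ℝ} {F : ℂ → ℂ}, min c₂ c₃ ≤ c → C ≤ C₁ + C₂ + C₃ →
      (∀ lam, c * |lam.im| * Real.exp (-(C * (1 + √‖lam‖))) ≤ ‖F lam‖) →
      ∀ lam, min c₂ c₃ * |lam.im| * Real.exp (-((C₁ + C₂ + C₃) * (1 + √‖lam‖))) ≤ ‖F lam‖ := by
    intro c C F hc hC h lam
    refine le_trans ?_ (h lam)
    have : 0 < c := lt_of_lt_of_le (lt_min hc₂ hc₃) hc
    gcongr
  refine exists_eq_const_mul_of_zeros (c := min c₂ c₃) (C := C₁ + C₂ + C₃) (K := K)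
    ((hy.differentiable_val.mul_const _).sub (hy.differentiable_deriv.mul_const _))
    ((hz.differentiable_val.mul_const _).sub (hz.differentiable_deriv.mul_const _))
    (lt_min hc₂ hc₃) (by positivity) hK (fun lam => ?_)
    (weaken (min_le_left _ _) (by linarith) (hlow₂ β))
    (weaken (min_le_right _ _) (by linarith) (hlow₃ β)) (fun lam => ?_)
  · calc _ ≤ ‖yR lam S‖ + ‖dyR lam S‖ := by
          refine (norm_sub_le _ _).trans ?_
          rw [norm_mul, norm_mul, Complex.norm_real, Complex.norm_real, Real.norm_eq_abs,
            Real.norm_eq_abs]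
          gcongr
          · exact mul_le_of_le_one_right (norm_nonneg _) (Real.abs_cos_le_one β)
          · exact mul_le_of_le_one_right (norm_nonneg _) (Real.abs_sin_le_one β)
      _ ≤ _ := hup lam
      _ ≤ _ := by gcongr; linarith
  · rw [← hy.mem_transferSpectrum_iff hS hqL hqR, ← hz.mem_transferSpectrum_iff hS hrL hrR, hspec]

/-- This is `y' ~ κ y` at `S` along the curve `lam k`, written as a ratio whose denominator is known
not to vanish. -/
theorem tendsto_factor_ratio (hS : 0 < S) (hqL : IntervalIntegrable q volume (-S) 0)
    (hqR : IntervalIntegrable q volume 0 S) (hM : 0 < M.det)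
    (h : IsTransferFamily S q M α yL dyL yR dyR) {κ lam : ℝ → ℂ}
    (hκ : ∀ k, κ k ^ 2 = -lam k) (hre : ∀ k, (κ k).re = k) (him : ∀ k, |(κ k).im| = |k|) :
    (∀ k, 0 < k → dyR (lam k) S + κ k * yR (lam k) S ≠ 0) ∧
    Tendsto (fun k => (dyR (lam k) S - κ k * yR (lam k) S) / (dyR (lam k) S + κ k * yR (lam k) S))
      atTop (𝓝 0) := by
  set Q := ∫ t in (0 : ℝ)..S, |q t| with hQ
  have him' : ∀ k, 0 < k → |(κ k).im| = (κ k).re := fun k hk => by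
    rw [him, hre, abs_of_pos hk]
  have hne : ∀ k, 0 < k → dyR (lam k) S + κ k * yR (lam k) S ≠ 0 := by
    intro k hk h0
    have h1 := IsSolutionOn.abs_im_mul_norm_le (hκ k) (by rwa [hre])
      ((h.right (lam k)).im_mul_im_nonpos (h.right_sign hS hM _) (right_mem_Icc.2 hS.le))
    rw [h0, him' k hk, hre, norm_zero] at h1
    have h2 : yR (lam k) S = 0 := norm_le_zero_iff.1 (by nlinarith [norm_nonneg (yR (lam k) S)])
    rw [h2, mul_zero, add_zero] at h0
    rcases h.right_ne_zero hS hqL hqR hM (lam k) with h3 | h3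
    · exact h3 h2
    · exact h3 h0
  refine ⟨hne, ?_⟩
  have hlim : Tendsto (fun k : ℝ => Real.exp (Q / k) * (5 * Real.exp (-(2 * (k * (S - 0)))) + Q / k))
      atTop (𝓝 0) := by
    have h1 : Tendsto (fun k : ℝ => Q / k) atTop (𝓝 0) := tendsto_const_nhds.div_atTop tendsto_id
    have h2 : Tendsto (fun k : ℝ => Real.exp (Q / k)) atTop (𝓝 1) := by
      have := (Real.continuous_exp.tendsto 0).comp h1
      rwa [Real.exp_zero] at this
    have h3 : Tendsto (fun k : ℝ => Real.exp (-(2 * (k * (S - 0))))) atTop (𝓝 0) := by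
      refine Real.tendsto_exp_neg_atTop_nhds_zero.comp ?_
      have : Tendsto (fun k : ℝ => k * (S - 0)) atTop atTop :=
        tendsto_id.atTop_mul_const (by simpa using hS)
      exact this.const_mul_atTop (by norm_num)
    simpa using h2.mul ((h3.const_mul 5).add h1)
  refine squeeze_zero_norm' ?_ hlim
  filter_upwards [eventually_gt_atTop 0] with k hk
  have h1 := (h.right (lam k)).factor_sub_le hS.le hqR (hκ k) (by rwa [hre]) (him' k hk)
    (h.right_sign hS hM _)
  rw [norm_div, div_le_iff₀ (norm_pos_iff.2 (hne k hk))]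
  rw [hre] at h1
  exact h1.trans (le_of_eq (mul_comm _ _))

end IsTransferFamily

/-- Write `p = v + κ u` and `n = v - κ u`, so `u = (p - n) / (2 κ)` and `v = (p + n) / 2` with `n /
p → 0`. If `sin β = 0` the term in `u` must be rescaled by `2 κ`; otherwise the term in `v`
dominates. Neither `l` nor `L` depends on the solution, so the same pair serves both potentials. -/
theorem exists_tendsto_boundary_form (β : ℝ) {κ : ℝ → ℂ} (hκ : ∀ k, (κ k).re = k) :
    ∃ (l : ℝ → ℂ) (L : ℂ), L ≠ 0 ∧ ∀ u v : ℝ → ℂ, (∀ k, 0 < k → v k + κ k * u k ≠ 0) →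
      Tendsto (fun k => (v k - κ k * u k) / (v k + κ k * u k)) atTop (𝓝 0) →
      Tendsto (fun k => l k * (u k * (Real.cos β : ℂ) - v k * (Real.sin β : ℂ)) /
        (v k + κ k * u k)) atTop (𝓝 L) := by
  have hκ0 : ∀ k, 0 < k → κ k ≠ 0 := fun k hk h0 => by
    have := hκ k
    rw [h0, Complex.zero_re] at this
    exact hk.ne this
  by_cases hs : Real.sin β = 0
  · refine ⟨fun k => 2 * κ k, Real.cos β, ?_, fun u v hne hw => ?_⟩
    · intro hc
      have := Real.sin_sq_add_cos_sq β
      rw [hs, Complex.ofReal_eq_zero.1 hc] at this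
      norm_num at this
    · have h1 := ((tendsto_const_nhds (x := (1 : ℂ))).sub hw).const_mul (Real.cos β : ℂ)
      rw [sub_zero, mul_one] at h1
      refine h1.congr' ?_
      filter_upwards [eventually_gt_atTop 0] with k hk
      have := hne k hk
      rw [hs]
      field_simp
      push_cast
      ring
  · refine ⟨fun _ => 2, -Real.sin β, ?_, fun u v hne hw => ?_⟩
    · exact neg_ne_zero.2 (Complex.ofReal_ne_zero.2 hs)
    · have hinv : Tendsto (fun k => (κ k)⁻¹) atTop (𝓝 0) := by
        refine squeeze_zero_norm' ?_ tendsto_inv_atTop_zero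
        filter_upwards [eventually_gt_atTop 0] with k hk
        rw [norm_inv]
        gcongr
        calc k = (κ k).re := (hκ k).symm
          _ ≤ ‖κ k‖ := Complex.re_le_norm _
      have h1 := ((((tendsto_const_nhds (x := (1 : ℂ))).sub hw).const_mul (Real.cos β : ℂ)).mul
        hinv).sub (((tendsto_const_nhds (x := (1 : ℂ))).add hw).const_mul (Real.sin β : ℂ))
      rw [mul_zero, add_zero, mul_one, zero_sub] at h1
      refine h1.congr' ?_
      filter_upwards [eventually_gt_atTop 0] with k hk
      have h2 := hne k hk
      have h3 := hκ0 k hk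
      field_simp
      ring

theorem sin_mul_cos_sub_ne_zero {β β' : ℝ} (hβ : β ∈ Ioc 0 Real.pi) (hβ' : β' ∈ Ioc 0 Real.pi)
    (h : β ≠ β') : (Real.sin β : ℂ) * Real.cos β' - Real.cos β * Real.sin β' ≠ 0 := by
  have h1 : Real.sin (β - β') ≠ 0 := by
    intro h0
    rw [Real.sin_eq_zero_iff_of_lt_of_lt (by linarith [hβ.1, hβ'.2]) (by linarith [hβ.2, hβ'.1])]
      at h0
    exact h (sub_eq_zero.1 h0)
  rw [Real.sin_sub] at h1
  exact_mod_cast h1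

/-- Equality of the two spectra makes the Cauchy data at `S` proportional, with a factor
independent of the spectral parameter. -/
theorem exists_cauchy_data_eq_const_mul {β β' : ℝ} (hS : 0 < S)
    (hqL : IntervalIntegrable q volume (-S) 0)
    (hqR : IntervalIntegrable q volume 0 S) (hrL : IntervalIntegrable r volume (-S) 0)
    (hrR : IntervalIntegrable r volume 0 S) (hM : 0 < M.det)
    (hβ : β ∈ Ioc 0 Real.pi) (hβ' : β' ∈ Ioc 0 Real.pi) (hββ' : β ≠ β')
    (hy : IsTransferFamily S q M α yL dyL yR dyR) (hz : IsTransferFamily S r M α zL dzL zR dzR)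
    (hspec : transferSpectrum S q M α β = transferSpectrum S r M α β)
    (hspec' : transferSpectrum S q M α β' = transferSpectrum S r M α β') :
    ∃ c : ℂ, ∀ lam, yR lam S = c * zR lam S ∧ dyR lam S = c * dzR lam S := by
  obtain ⟨c, hc, hcF⟩ := hy.exists_proportional hS hqL hqR hrL hrR hM hz hspec
  obtain ⟨c', hc', hcF'⟩ := hy.exists_proportional hS hqL hqR hrL hrR hM hz hspec'
  set κ : ℝ → ℂ := fun k => k * (1 - Complex.I) with hκdef
  set lam : ℝ → ℂ := fun k => 2 * k ^ 2 * Complex.I with hlam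
  have hκ : ∀ k, κ k ^ 2 = -lam k := fun k => by
    simp only [hκdef, hlam]; linear_combination (k : ℂ) ^ 2 * Complex.I_sq
  have hre : ∀ k, (κ k).re = k := fun k => by simp [hκdef]
  have him : ∀ k, |(κ k).im| = |k| := fun k => by simp [hκdef]
  obtain ⟨hney, hty⟩ := hy.tendsto_factor_ratio hS hqL hqR hM hκ hre him
  obtain ⟨hnez, htz⟩ := hz.tendsto_factor_ratio hS hrL hrR hM hκ hre him
  -- Dividing the two boundary forms cancels `l` and `L`, so the ratio of the growing factors tends
  -- to the proportionality constant. That ratio does not involve the angle, hence the constants for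
  -- `β` and `β'` coincide.
  have ratio : ∀ (β : ℝ) (c : ℂ), c ≠ 0 →
      (∀ lam, yR lam S * (Real.cos β : ℂ) - dyR lam S * (Real.sin β : ℂ) =
        c * (zR lam S * (Real.cos β : ℂ) - dzR lam S * (Real.sin β : ℂ))) →
      Tendsto (fun k => (dyR (lam k) S + κ k * yR (lam k) S) /
        (dzR (lam k) S + κ k * zR (lam k) S)) atTop (𝓝 c) := by
    intro β c hc hF
    obtain ⟨l, L, hL, H⟩ := exists_tendsto_boundary_form β hre
    have h1 := H _ _ hney hty
    have h2 := H _ _ hnez htz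
    have h3 := (h2.const_mul c).div h1 hL
    rw [mul_div_cancel_right₀ _ hL] at h3
    refine h3.congr' ?_
    filter_upwards [eventually_gt_atTop 0, h1.eventually_ne hL] with k hk h4
    have h5 := hney k hk
    have h6 := hnez k hk
    simp only [Pi.div_apply]
    rw [hF] at h4 ⊢
    obtain ⟨h7, h8⟩ := mul_ne_zero_iff.1 (div_ne_zero_iff.1 h4).1
    have h9 := (mul_ne_zero_iff.1 h8).2
    field_simp
  have hcc : c = c' := tendsto_nhds_unique (ratio β c hc hcF) (ratio β' c' hc' hcF')
  subst hcc
  have hd := sin_mul_cos_sub_ne_zero hβ hβ' hββ'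
  refine ⟨c, fun lam => ⟨?_, ?_⟩⟩ <;> refine sub_eq_zero.1 ((mul_eq_zero.1 ?_).resolve_left hd)
  · linear_combination (-(Real.sin β' : ℂ)) * hcF lam + (Real.sin β : ℂ) * hcF' lam
  · linear_combination (-(Real.cos β' : ℂ)) * hcF lam + (Real.cos β : ℂ) * hcF' lam

theorem im_conj_const_mul (c u v : ℂ) :
    (conj (c * u) * (c * v)).im = Complex.normSq c * (conj u * v).im := by
  rw [Complex.normSq_apply]
  simp only [map_mul, Complex.mul_im, Complex.mul_re, Complex.conj_re, Complex.conj_im]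
  ring

/-- Scaling the second family by the constant `c` turns proportional Cauchy data into equal ones,
and multiplies the Weyl sign by `|c|² ≥ 0`. The right half is treated first because the data are
known at `S`. -/
theorem ae_eq_of_transferSpectrum_eq {β β' : ℝ} (hS : 0 < S)
    (hqL : IntervalIntegrable q volume (-S) 0) (hqR : IntervalIntegrable q volume 0 S)
    (hrL : IntervalIntegrable r volume (-S) 0) (hrR : IntervalIntegrable r volume 0 S)
    (hM : 0 < M.det) (hβ : β ∈ Ioc 0 Real.pi) (hβ' : β' ∈ Ioc 0 Real.pi) (hββ' : β ≠ β')
    (hspec : transferSpectrum S q M α β = transferSpectrum S r M α β)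
    (hspec' : transferSpectrum S q M α β' = transferSpectrum S r M α β') :
    (∀ᵐ x, x ∈ Icc (-S) 0 → q x = r x) ∧ ∀ᵐ x, x ∈ Icc 0 S → q x = r x := by
  obtain ⟨yL, dyL, yR, dyR, hy⟩ := exists_isTransferFamily hS.le hqL hqR M α
  obtain ⟨zL, dzL, zR, dzR, hz⟩ := exists_isTransferFamily hS.le hrL hrR M α
  obtain ⟨c, hc⟩ := exists_cauchy_data_eq_const_mul hS hqL hqR hrL hrR hM hβ hβ' hββ' hy hz
    hspec hspec'
  have hzR := fun lam => (hz.right lam).const_mul c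
  have hzL := fun lam => (hz.left lam).const_mul c
  have right : ∀ᵐ x, x ∈ Icc 0 S → q x = r x := by
    refine potential_ae_eq_of_cauchy_data_eq hS hqR hrR hy.right hzR (hy.right_sign hS hM)
      (fun lam => ?_) (hy.right_ne_zero hS hqL hqR hM) (fun lam => (hc lam).1) (fun lam => (hc lam).2)
    rw [im_conj_const_mul]
    have := hz.right_sign hS hM lam
    nlinarith [Complex.normSq_nonneg c]
  refine ⟨?_, right⟩
  -- Now that the potentials agree on `[0, S]`, both families solve the same equation there, so
  -- equality at `S` propagates back to `0⁺` and, by invertibility of `M`, to `0⁻`.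
  have h0 : ∀ lam, yL lam 0 = c * zL lam 0 ∧ dyL lam 0 = c * dzL lam 0 := by
    intro lam
    have e := (hy.right lam).eqOn_of_eq hS.le hqR ((hzR lam).congr_potential (by
      filter_upwards [right] with x hx hx' using (hx hx').symm)) (right_mem_Icc.2 hS.le)
      (hc lam).1 (hc lam).2
    have e1 := e.1 (left_mem_Icc.2 hS.le)
    have e2 := e.2 (left_mem_Icc.2 hS.le)
    simp only [hy.transfer_val, hz.transfer_val] at e1
    simp only [hy.transfer_deriv, hz.transfer_deriv] at e2
    exact eq_of_matrix_fin_two_eq hM (by rw [e1]; ring) (by rw [e2]; ring)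
  refine potential_ae_eq_of_cauchy_data_eq (neg_lt_zero.2 hS) hqL hrL hy.left hzL
    (fun lam => ?_) (fun lam => ?_) (hy.left_ne_zero hS hqL) (fun lam => (h0 lam).1)
    (fun lam => (h0 lam).2)
  · rw [hy.left_sign, mul_zero]
  · rw [im_conj_const_mul, hz.left_sign, mul_zero, mul_zero]

end TwoSpectra

theorem corollary4p4 (S : ℝ) (hS : 0 < S)
    (M : Matrix (Fin 2) (Fin 2) ℝ) (hM : 0 < M.det)
    (α : ℝ) (hα : α ∈ Set.Ico 0 Real.pi)
    (β β' : ℝ) (hβ : β ∈ Set.Ioc 0 Real.pi) (hβ' : β' ∈ Set.Ioc 0 Real.pi) (hββ' : β ≠ β')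
    (q r : ℝ → ℝ)
    (hq : MeasureTheory.MemLp q 2 (MeasureTheory.volume.restrict (Set.Icc (-S) S)))
    (hr : MeasureTheory.MemLp r 2 (MeasureTheory.volume.restrict (Set.Icc (-S) S)))
    (hspec : transferSpectrum S q M α β = transferSpectrum S r M α β)
    (hspec' : transferSpectrum S q M α β' = transferSpectrum S r M α β') :
    ∀ᵐ x ∂(MeasureTheory.volume.restrict (Set.Icc (-S) S)), q x = r x := by
  have hint : ∀ {f : ℝ → ℝ}, MemLp f 2 (volume.restrict (Icc (-S) S)) →
      IntervalIntegrable f volume (-S) 0 ∧ IntervalIntegrable f volume 0 S := by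
    intro f hf
    have h1 : IntegrableOn f (Icc (-S) S) := hf.integrable one_le_two
    have h2 : IntervalIntegrable f volume (-S) S := by
      rwa [intervalIntegrable_iff_integrableOn_Icc_of_le (by linarith)]
    constructor <;> refine h2.mono_set ?_
    · rw [uIcc_of_le (by linarith), uIcc_of_le (by linarith)]
      exact Icc_subset_Icc le_rfl hS.le
    · rw [uIcc_of_le hS.le, uIcc_of_le (by linarith)]
      exact Icc_subset_Icc (by linarith) le_rfl
  obtain ⟨hqL, hqR⟩ := hint hq
  obtain ⟨hrL, hrR⟩ := hint hr
  obtain ⟨hL, hR⟩ := ae_eq_of_transferSpectrum_eq hS hqL hqR hrL hrR hM hβ hβ' hββ' hspec hspec'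
  rw [ae_restrict_iff' measurableSet_Icc]
  filter_upwards [hL, hR] with x h1 h2 hx
  rcases le_total x 0 with h | h
  · exact h1 ⟨hx.1, h⟩
  · exact h2 ⟨h, hx.2⟩
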